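/- **Setting.** A depth-$d$ $\mathsf{QAC}$ circuit on a finite set of qubits is a unitary of the form $U=L_dM_d\cdots L_1M_1L_0$, where each $L_i$ is a tensor product of arbitrary single-qubit unitaries and each $M_i$ is a tensor product of gates $\mathrm{CZ}_S=I-2|1\rangle\langle 1|^{\otimes S}$ acting on pairwise disjoint nonempty sets $S$ of qubits (of any sizes). Let the qubits consist of $n$ input qubits and $a$ ancillae, where the ancillae are initialized to an arbitrary density operator $\varphi$ that does not depend on the input, and let $o$ be any one of the $n+a$ qubits, the output qubit (for instance the first one). On input $x\in\{0,1\}^n$ the circuit outputs the bit $b$ with probability $\mathrm{Tr}\big[(|b\rangle\langle b|_o\otimes I)\,U(|x\rangle\langle x|\otimes\varphi)U^\dagger\big]$. It computes $f:\{0,1\}^n\to\{0,1\}$ with worst-case error $\delta$ if, for every $x$, it outputs $1-f(x)$ with probability at most $\delta$. The $\varepsilon$-approximate degree of $f$ is $\widetilde{\deg}_\varepsilon(f)=\min\{\deg g: g:\{0,1\}^n\to\mathbb R,\ \max_x|f(x)-g(x)|\le\varepsilon\}$, where $\deg g$ is the largest $|S|$ with a nonzero Fourier coefficient $\widehat g(S)=2^{-n}\sum_x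 g(x)(-1)^{\sum_{i\in S}x_i}$ (and $\deg 0=0$). **Theorem.** 1. There is an absolute constant $K\in\mathbb N$ such that for every $\kappa>0$ there is $C>0$, depending only on $\kappa$, with the following property. Let $n\ge1$ and $a,d\ge0$ be integers. If a depth-$d$ $\mathsf{QAC}$ circuit with $n$ input qubits and $a$ ancillae, initialized to some state $\varphi$, computes $f:\{0,1\}^n\to\{0,1\}$ with worst-case error $\delta$, then $$\widetilde{\deg}_{\delta+\kappa d/n}(f)\le C\,(n+a)^{1-3^{-d}}\,\big(\log(n+a+1)\big)^K .$$ That is, $\widetilde{\deg}_{\varepsilon}(f)=\tilde O\big((n+a)^{1-3^{-d}}\big)$ for $\varepsilon=\delta+O(d/n)$. 2. There is an absolute constant $K\in\mathbb N$ such that for all $c>0$ and $\delta<1/2$ there is $C>0$, depending only on $c$ and $\delta$, and for every $d\ge0$ there is $n_0$, depending only on $c,\delta,d$, with the following property. Let $n\ge n_0$ and let $f:\{0,1\}^n\to\{0,1\}$ satisfy $\widetilde{\deg}_{1/3}(f)\ge cn$. If a depth-$d$ $\mathsf{QAC}$ circuit with $n$ input qubits and $a$ ancillae, initialized to some state $\varphi$,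 computes $f$ with worst-case error $\delta$, then $$a\ \ge\ \frac{C\,n^{1+3^{-d}}}{\big(\log(n+1)\big)^K}.$$ That is, $a=\tilde\Omega\big(n^{1+3^{-d}}\big)$. -/

import Mathlib

noncomputable section

/-! ### Fourier degree and approximate degree of real functions on the Boolean cube -/

/-- The character `χ_S(x) = (-1)^(∑_{i ∈ S} x_i)`. -/
def cubeCharacter {n : ℕ} (S : Finset (Fin n)) (x : Fin n → Bool) : ℝ :=
  ∏ i ∈ S, (if x i then (-1 : ℝ) else 1)

/-- The Fourier coefficient `𝔼_x [g(x) χ_S(x)]`, with `x` uniform on `{0,1}^n`. -/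
def fourierCoefficient {n : ℕ} (g : (Fin n → Bool) → ℝ) (S : Finset (Fin n)) : ℝ :=
  (∑ x : Fin n → Bool, g x * cubeCharacter S x) / 2 ^ n

open Classical in
/-- The largest `|S|` with a nonzero Fourier coefficient at `S` (and `0` for `g = 0`). -/
def fourierDegree {n : ℕ} (g : (Fin n → Bool) → ℝ) : ℕ :=
  (Finset.univ.filter fun S : Finset (Fin n) => fourierCoefficient g S ≠ 0).sup Finset.card

/-- The `ε`-approximate degree: the least degree of a real function that is within `ε` of `f` in
the supremum norm. For `ε ≥ 0` the set is nonempty, as it contains the degree of `f`. -/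
def approxDegree {n : ℕ} (ε : ℝ) (f : (Fin n → Bool) → ℝ) : ℕ :=
  sInf {m : ℕ | ∃ g : (Fin n → Bool) → ℝ, (∀ x, |f x - g x| ≤ ε) ∧ fourierDegree g = m}

/-- A Boolean function, seen as a `0/1`-valued real function. -/
def boolToReal {n : ℕ} (f : (Fin n → Bool) → Bool) : (Fin n → Bool) → ℝ :=
  fun x => if f x then 1 else 0

/-! ### Operators on registers of qubits

The qubits are labelled by a finite type `Q`; the computational basis is `Q → Bool`, where `false`
stands for `|0⟩` and `true` for `|1⟩`. -/

/-- Operators on the Hilbert space of the qubits `Q`, in the computational basis. -/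
abbrev QubitOp (Q : Type) : Type := Matrix (Q → Bool) (Q → Bool) ℂ

open scoped ComplexOrder in
/-- A density operator: positive semidefinite of trace one. -/
def IsDensityOperator {Q : Type} [Fintype Q] [DecidableEq Q] (ρ : QubitOp Q) : Prop :=
  ρ.PosSemidef ∧ ρ.trace = 1

/-- The tensor product `⊗_i V_i` of one single-qubit unitary per qubit. -/
def singleQubitLayer {Q : Type} [Fintype Q] (V : Q → Matrix.unitaryGroup Bool ℂ) : QubitOp Q :=
  Matrix.of fun u v => ∏ i, (V i : Matrix Bool Bool ℂ) (u i) (v i)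

/-- The `CZ` gate `I - 2 |1⋯1⟩⟨1⋯1|` on the qubits in `S`, tensored with the identity on the
other qubits. -/
def czGate {Q : Type} [Fintype Q] [DecidableEq Q] (S : Finset Q) : QubitOp Q :=
  1 - (2 : ℂ) • Matrix.diagonal fun u => if ∀ i ∈ S, u i = true then (1 : ℂ) else 0

/-- A layer of multi-qubit `CZ` gates acting on pairwise disjoint nonempty sets of qubits. -/
structure CZLayer (Q : Type) where
  gates : List (Finset Q)
  nonempty : ∀ S ∈ gates, S.Nonempty
  disjoint : gates.Pairwise Disjoint

/-- The unitary of a layer of `CZ` gates. The factors commute and act on disjoint sets of qubits,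
so the product is the tensor product of the gates. -/
def CZLayer.toOp {Q : Type} [Fintype Q] [DecidableEq Q] (M : CZLayer Q) : QubitOp Q :=
  (M.gates.map czGate).prod

/-- `QAC` circuits of depth `d` on the qubits `Q`: an alternation `L_d M_d ⋯ L_1 M_1 L_0` of `d + 1`
layers `L_i` of single-qubit unitaries and `d` layers `M_i` of `CZ` gates. -/
inductive QACCircuit (Q : Type) : ℕ → Type
  | base (V : Q → Matrix.unitaryGroup Bool ℂ) : QACCircuit Q 0
  | step {d : ℕ} (U : QACCircuit Q d) (M : CZLayer Q) (V : Q → Matrix.unitaryGroup Bool ℂ) :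
      QACCircuit Q (d + 1)

/-- The unitary operator implemented by a circuit. -/
def QACCircuit.toOp {Q : Type} [Fintype Q] [DecidableEq Q] :
    {d : ℕ} → QACCircuit Q d → QubitOp Q
  | _, .base V => singleQubitLayer V
  | _, .step U M V => singleQubitLayer V * M.toOp * U.toOp

/-! ### Computing a Boolean function

The `n` input qubits are `Sum.inl i`, the `a` ancillae are `Sum.inr j`. -/

/-- The initial state `|x⟩⟨x| ⊗ φ`. -/
def initialState {n a : ℕ} (φ : QubitOp (Fin a)) (x : Fin n → Bool) : QubitOp (Fin n ⊕ Fin a) :=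
  Matrix.of fun u v =>
    if (∀ i, u (Sum.inl i) = x i) ∧ (∀ i, v (Sum.inl i) = x i) then
      φ (fun j => u (Sum.inr j)) (fun j => v (Sum.inr j))
    else 0

/-- The projector `|b⟩⟨b|` on the qubit `o`, tensored with the identity on the other qubits. -/
def measurementProjector {Q : Type} [Fintype Q] [DecidableEq Q] (o : Q) (b : Bool) : QubitOp Q :=
  Matrix.diagonal fun u => if u o = b then (1 : ℂ) else 0

/-- The probability that the measurement of the qubit `o` at the end of the computation on input `x`
gives `b`: the trace of `(|b⟩⟨b| ⊗ I) U (|x⟩⟨x| ⊗ φ) U†`, which is a real number whenever `φ` is a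
density operator. -/
def outputProbability {n a d : ℕ} (U : QACCircuit (Fin n ⊕ Fin a) d) (o : Fin n ⊕ Fin a)
    (φ : QubitOp (Fin a)) (x : Fin n → Bool) (b : Bool) : ℝ :=
  (measurementProjector o b * (U.toOp * initialState φ x * U.toOp.conjTranspose)).trace.re

/-- The circuit `U` with ancillae in state `φ` and output qubit `o` computes `f` with worst-case
error `δ`: on every input `x`, the outcome differs from `f x` with probability at most `δ`. -/
def ComputesWithError {n a d : ℕ} (U : QACCircuit (Fin n ⊕ Fin a) d) (o : Fin n ⊕ Fin a)
    (φ : QubitOp (Fin a)) (f : (Fin n → Bool) → Bool) (δ : ℝ) : Prop :=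
  ∀ x, outputProbability U o φ x (!f x) ≤ δ

end

/-! The measurement projector has degree one. The proof follows it in the Heisenberg picture, where
it is conjugated by the layers of the circuit from the last to the first, and tracks the degree of
an operator close to it in norm. Single-qubit layers preserve degree. In a `CZ` layer the gates are
split at a size threshold `s`. Conjugation by the small gates is exact and enlarges supports to
light cones, so the degree is multiplied by at most `s` (`conj_czProd_mem_opDegreeLE`). Each large
gate on `k` qubits is replaced by a Chebyshev polynomial of degree `O(Λ √k)` in the Hamming weight
(`exists_approx_czSign`); since the gates are disjoint, this adds only `O(Λ N / √s)` in total
(`exists_approx_conj_czProd`).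

Starting from degree about `N ^ (1 - 3⁻ʲ)`, the choice `s = N ^ (2 · 3⁻⁽ʲ⁺¹⁾)` balances both
contributions at `N ^ (1 - 3⁻⁽ʲ⁺¹⁾)`; iterating gives `exists_approx_heisenberg`. The expectation of
a degree-`r` operator in `|x⟩⟨x| ⊗ φ` is a function of `x` of degree at most `r`
(`trace_mul_initialState_mem_cubeDegreeLE`), and norm error bounds pointwise error
(`norm_trace_mul_le`). Taking `Λ` logarithmic in `N` gives the upper bound on approximate degree.

For the ancilla bound, `exists_amplification` turns error below `1/2` into error `1/3` at a constant
factor in degree. If `a < n ^ (1 + θ)` with `θ = 3⁻ᵈ`, the degree is `n ^ (1 - θ²)` up to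
logarithms, which is eventually below `c n`. -/

/-! ### Product operators and operators supported on a set of qubits -/

section Support

set_option linter.unusedSectionVars false

variable {Q : Type} [Fintype Q] [DecidableEq Q]

/-- The tensor product `⊗_i W_i` of one single-qubit operator per qubit. -/
def tensorOp (W : Q → Matrix Bool Bool ℂ) : QubitOp Q :=
  Matrix.of fun u v => ∏ i, W i (u i) (v i)

theorem tensorOp_apply (W : Q → Matrix Bool Bool ℂ) (u v : Q → Bool) :
    tensorOp W u v = ∏ i, W i (u i) (v i) := rfl

theorem tensorOp_mul (W W' : Q → Matrix Bool Bool ℂ) :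
    tensorOp W * tensorOp W' = tensorOp (fun i => W i * W' i) := by
  ext u v
  simp only [tensorOp_apply, Matrix.mul_apply, Finset.prod_univ_sum, Finset.prod_mul_distrib,
    Fintype.piFinset_univ]

theorem tensorOp_diagonal (f : Q → Bool → ℂ) :
    tensorOp (fun i => Matrix.diagonal (f i)) = Matrix.diagonal fun u => ∏ i, f i (u i) := by
  ext u v
  by_cases h : u = v
  · subst h
    simp [tensorOp_apply]
  · obtain ⟨i, hi⟩ := Function.ne_iff.1 h
    rw [Matrix.diagonal_apply_ne _ h, tensorOp_apply]
    exact Finset.prod_eq_zero (Finset.mem_univ i) (Matrix.diagonal_apply_ne _ hi)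

theorem tensorOp_one : tensorOp (fun _ : Q => (1 : Matrix Bool Bool ℂ)) = 1 := by
  simpa using tensorOp_diagonal (fun (_ : Q) _ => (1 : ℂ))

theorem tensorOp_conjTranspose (W : Q → Matrix Bool Bool ℂ) :
    (tensorOp W).conjTranspose = tensorOp fun i => (W i).conjTranspose := by
  ext u v
  simp [tensorOp_apply, Matrix.conjTranspose_apply]

theorem singleQubitLayer_eq_tensorOp (V : Q → Matrix.unitaryGroup Bool ℂ) :
    singleQubitLayer V = tensorOp fun i => (V i : Matrix Bool Bool ℂ) := rfl

theorem singleQubitLayer_mul_conjTranspose (V : Q → Matrix.unitaryGroup Bool ℂ) :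
    singleQubitLayer V * (singleQubitLayer V).conjTranspose = 1 := by
  rw [singleQubitLayer_eq_tensorOp, tensorOp_conjTranspose, tensorOp_mul, ← tensorOp_one]
  congr 1
  funext i
  exact Matrix.mem_unitaryGroup_iff.1 (V i).2

theorem singleQubitLayer_conjTranspose_mul (V : Q → Matrix.unitaryGroup Bool ℂ) :
    (singleQubitLayer V).conjTranspose * singleQubitLayer V = 1 :=
  mul_eq_one_comm.1 (singleQubitLayer_mul_conjTranspose V)

/-- The single-qubit operator `m` acting on the qubit `i`. -/
def qubitAct (i : Q) (m : Matrix Bool Bool ℂ) : QubitOp Q :=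
  tensorOp (Function.update (fun _ => 1) i m)

theorem qubitAct_apply_eq_zero {i j : Q} (m : Matrix Bool Bool ℂ) {u v : Q → Bool} (hji : j ≠ i)
    (h : u j ≠ v j) : qubitAct i m u v = 0 := by
  refine Finset.prod_eq_zero (Finset.mem_univ j) ?_
  simp [hji, Matrix.one_apply_ne h]

theorem qubitAct_diagonal (i : Q) (f : Bool → ℂ) :
    qubitAct i (Matrix.diagonal f) = Matrix.diagonal fun u => f (u i) := by
  have h : (Function.update (fun _ => 1) i (Matrix.diagonal f) : Q → Matrix Bool Bool ℂ) =
      fun j => Matrix.diagonal (Function.update (fun _ _ => (1 : ℂ)) i f j) := by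
    funext j
    rcases eq_or_ne j i with rfl | hj
    · simp
    · simp [hj]
  rw [qubitAct, h, tensorOp_diagonal]
  congr 1
  funext u
  rw [Finset.prod_eq_single i] <;> simp +contextual

theorem singleQubitLayer_mul_qubitAct (V : Q → Matrix.unitaryGroup Bool ℂ) (i : Q)
    (m : Matrix Bool Bool ℂ) :
    singleQubitLayer V * qubitAct i m =
      qubitAct i (V i * m * (V i : Matrix Bool Bool ℂ).conjTranspose) * singleQubitLayer V := by
  rw [singleQubitLayer_eq_tensorOp, qubitAct, qubitAct, tensorOp_mul, tensorOp_mul]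
  congr 1
  funext j
  rcases eq_or_ne j i with rfl | hj
  · have h : (V j : Matrix Bool Bool ℂ).conjTranspose * (V j : Matrix Bool Bool ℂ) = 1 :=
      Matrix.mem_unitaryGroup_iff'.1 (V j).2
    simp [mul_assoc, h]
  · simp [hj]

/-- The operators of the form `B ⊗ I` with `B` acting on the qubits in `T`, described as those which
commute with all single-qubit operators on the other qubits. -/
def supportedOn (T : Finset Q) : Subalgebra ℂ (QubitOp Q) :=
  Subalgebra.centralizer ℂ {X | ∃ i, i ∉ T ∧ ∃ m, X = qubitAct i m}

theorem mem_supportedOn {T : Finset Q} {A : QubitOp Q} :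
    A ∈ supportedOn T ↔ ∀ i, i ∉ T → ∀ m, qubitAct i m * A = A * qubitAct i m := by
  rw [supportedOn, Subalgebra.mem_centralizer_iff]
  constructor
  · exact fun h i hi m => h _ ⟨i, hi, m, rfl⟩
  · rintro h _ ⟨i, hi, m, rfl⟩
    exact h i hi m

theorem supportedOn_mono {T T' : Finset Q} (h : T ⊆ T') : supportedOn T ≤ supportedOn T' := by
  intro A hA
  rw [mem_supportedOn] at hA ⊢
  exact fun i hi => hA i fun h' => hi (h h')

/-- Commuting with `|1⟩⟨1|` on qubit `i` forces the entries of `A` that flip this qubit to vanish.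
-/
theorem apply_eq_zero_of_mem_supportedOn {T : Finset Q} {A : QubitOp Q} (hA : A ∈ supportedOn T)
    {i : Q} (hi : i ∉ T) {u v : Q → Bool} (h : u i ≠ v i) : A u v = 0 := by
  have key := mem_supportedOn.1 hA i hi (Matrix.diagonal fun b => if b then 1 else 0)
  rw [qubitAct_diagonal] at key
  have key' := congrFun (congrFun key u) v
  rw [Matrix.diagonal_mul, Matrix.mul_diagonal] at key'
  cases hu : u i <;> cases hv : v i <;> simp_all

theorem diagonal_mem_supportedOn {T : Finset Q} {f : (Q → Bool) → ℂ}
    (hf : ∀ u v, (∀ j ∈ T, u j = v j) → f u = f v) : Matrix.diagonal f ∈ supportedOn T := by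
  refine mem_supportedOn.2 fun i hi m => ?_
  ext u v
  rw [Matrix.diagonal_mul, Matrix.mul_diagonal]
  by_cases h : ∀ j ∈ T, u j = v j
  · rw [hf u v h, mul_comm]
  · push Not at h
    obtain ⟨j, hj, hne⟩ := h
    rw [qubitAct_apply_eq_zero m (fun h : j = i => hi (h ▸ hj)) hne]
    simp

/-- A nonzero entry of `A` joins basis states that agree off `T`, hence on `S`, where `f` cannot
tell them apart. -/
theorem commute_diagonal_of_mem_supportedOn {T S : Finset Q} (hTS : Disjoint T S) {A : QubitOp Q}
    (hA : A ∈ supportedOn T) {f : (Q → Bool) → ℂ}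
    (hf : ∀ u v, (∀ j ∈ S, u j = v j) → f u = f v) : Commute (Matrix.diagonal f) A := by
  ext u v
  rw [Matrix.diagonal_mul, Matrix.mul_diagonal]
  by_cases h : ∀ j ∈ S, u j = v j
  · rw [hf u v h, mul_comm]
  · push Not at h
    obtain ⟨j, hj, hne⟩ := h
    rw [apply_eq_zero_of_mem_supportedOn hA (fun h' => (Finset.disjoint_left.1 hTS h' hj)) hne]
    simp

/-- The layer carries a single-qubit operator on `i` to another one on the same `i`, so the
commutation conditions defining the support are preserved. -/
theorem conj_singleQubitLayer_mem_supportedOn {T : Finset Q} {A : QubitOp Q}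
    (hA : A ∈ supportedOn T) (V : Q → Matrix.unitaryGroup Bool ℂ) :
    (singleQubitLayer V).conjTranspose * A * singleQubitLayer V ∈ supportedOn T := by
  refine mem_supportedOn.2 fun i hi m => ?_
  set L := singleQubitLayer V
  set X := qubitAct i m
  obtain ⟨Y, hLX, hYA⟩ : ∃ Y, L * X = Y * L ∧ Y * A = A * Y :=
    ⟨_, singleQubitLayer_mul_qubitAct V i m, mem_supportedOn.1 hA i hi _⟩
  have h1 : L.conjTranspose * L = 1 := singleQubitLayer_conjTranspose_mul V
  have h2 : L * L.conjTranspose = 1 := singleQubitLayer_mul_conjTranspose V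
  have hXL : X * L.conjTranspose = L.conjTranspose * Y := by
    calc X * L.conjTranspose = L.conjTranspose * (L * X) * L.conjTranspose := by
          rw [← mul_assoc, h1, one_mul]
      _ = L.conjTranspose * Y * (L * L.conjTranspose) := by rw [hLX]; simp only [mul_assoc]
      _ = L.conjTranspose * Y := by rw [h2, mul_one]
  calc X * (L.conjTranspose * A * L) = X * L.conjTranspose * A * L := by simp only [mul_assoc]
    _ = L.conjTranspose * (Y * A) * L := by rw [hXL]; simp only [mul_assoc]
    _ = L.conjTranspose * A * (Y * L) := by rw [hYA]; simp only [mul_assoc]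
    _ = L.conjTranspose * A * L * X := by rw [← hLX]; simp only [mul_assoc]

/-! ### The degree filtration on operators -/

variable (Q) in
/-- The operators of degree at most `r`: linear combinations of operators supported on at most `r`
qubits. -/
def opDegreeLE (r : ℝ) : Submodule ℂ (QubitOp Q) :=
  Submodule.span ℂ {A | ∃ T : Finset Q, (T.card : ℝ) ≤ r ∧ A ∈ supportedOn T}

theorem mem_opDegreeLE_of_mem_supportedOn {T : Finset Q} {A : QubitOp Q} (hA : A ∈ supportedOn T)
    {r : ℝ} (hr : (T.card : ℝ) ≤ r) : A ∈ opDegreeLE Q r :=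
  Submodule.subset_span ⟨T, hr, hA⟩

theorem opDegreeLE_mono {r r' : ℝ} (h : r ≤ r') : opDegreeLE Q r ≤ opDegreeLE Q r' :=
  Submodule.span_mono fun _ ⟨T, hT, hA⟩ => ⟨T, hT.trans h, hA⟩

theorem one_mem_opDegreeLE {r : ℝ} (hr : 0 ≤ r) : (1 : QubitOp Q) ∈ opDegreeLE Q r :=
  mem_opDegreeLE_of_mem_supportedOn (T := ∅) (one_mem _) (by simpa using hr)

theorem mul_mem_opDegreeLE {r r' : ℝ} {A B : QubitOp Q} (hA : A ∈ opDegreeLE Q r)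
    (hB : B ∈ opDegreeLE Q r') : A * B ∈ opDegreeLE Q (r + r') := by
  have h := Submodule.mul_mem_mul hA hB
  rw [opDegreeLE, opDegreeLE, Submodule.span_mul_span] at h
  refine Submodule.span_le.2 ?_ h
  rintro _ ⟨A, ⟨T, hT, hA⟩, B, ⟨T', hT', hB⟩, rfl⟩
  refine mem_opDegreeLE_of_mem_supportedOn (T := T ∪ T') (mul_mem
    (supportedOn_mono Finset.subset_union_left hA)
    (supportedOn_mono Finset.subset_union_right hB)) ?_
  have : ((T ∪ T').card : ℝ) ≤ T.card + T'.card := mod_cast Finset.card_union_le T T'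
  linarith

theorem pow_mem_opDegreeLE {A : QubitOp Q} (hA : A ∈ opDegreeLE Q 1) (k : ℕ) :
    A ^ k ∈ opDegreeLE Q k := by
  induction k with
  | zero => simpa using one_mem_opDegreeLE (Q := Q) le_rfl
  | succ k ih =>
    rw [pow_succ, Nat.cast_succ]
    exact mul_mem_opDegreeLE ih hA

theorem aeval_mem_opDegreeLE {A : QubitOp Q} (hA : A ∈ opDegreeLE Q 1) (p : Polynomial ℂ) :
    Polynomial.aeval A p ∈ opDegreeLE Q p.natDegree := by
  rw [Polynomial.aeval_eq_sum_range]
  refine Submodule.sum_mem _ fun k hk => Submodule.smul_mem _ _ ?_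
  refine opDegreeLE_mono ?_ (pow_mem_opDegreeLE hA k)
  exact_mod_cast Nat.lt_succ_iff.1 (Finset.mem_range.1 hk)

theorem linearMap_mem_opDegreeLE {r r' : ℝ} (F : QubitOp Q →ₗ[ℂ] QubitOp Q)
    (h : ∀ T : Finset Q, (T.card : ℝ) ≤ r → ∀ A ∈ supportedOn T, F A ∈ opDegreeLE Q r')
    {A : QubitOp Q} (hA : A ∈ opDegreeLE Q r) : F A ∈ opDegreeLE Q r' := by
  have : opDegreeLE Q r ≤ (opDegreeLE Q r').comap F :=
    Submodule.span_le.2 fun A ⟨T, hT, hA⟩ => h T hT A hA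
  exact this hA

/-- Conjugation `A ↦ B A C` as a linear map. -/
def sandwich (B C : QubitOp Q) : QubitOp Q →ₗ[ℂ] QubitOp Q :=
  LinearMap.mulLeft ℂ B ∘ₗ LinearMap.mulRight ℂ C

theorem sandwich_apply (B C A : QubitOp Q) : sandwich B C A = B * A * C := by
  simp [sandwich, mul_assoc]

theorem conj_singleQubitLayer_mem_opDegreeLE {r : ℝ} {A : QubitOp Q} (hA : A ∈ opDegreeLE Q r)
    (V : Q → Matrix.unitaryGroup Bool ℂ) :
    (singleQubitLayer V).conjTranspose * A * singleQubitLayer V ∈ opDegreeLE Q r := by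
  rw [← sandwich_apply]
  refine linearMap_mem_opDegreeLE _ (fun T hT A hA => ?_) hA
  rw [sandwich_apply]
  exact mem_opDegreeLE_of_mem_supportedOn (conj_singleQubitLayer_mem_supportedOn hA V) hT

end Support

/-! ### Layers of `CZ` gates -/

section CZ

set_option linter.unusedSectionVars false

variable {Q : Type} [Fintype Q] [DecidableEq Q]

/-- The diagonal of `czGate S`. -/
def czSign (S : Finset Q) (u : Q → Bool) : ℂ := if ∀ i ∈ S, u i = true then -1 else 1

theorem czGate_eq_diagonal (S : Finset Q) : czGate S = Matrix.diagonal (czSign S) := by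
  rw [czGate, ← Matrix.diagonal_one, ← Matrix.diagonal_smul, Matrix.diagonal_sub]
  congr 1
  funext u
  simp only [czSign, Pi.smul_apply, smul_eq_mul]
  split_ifs <;> norm_num

theorem czSign_congr {S : Finset Q} {u v : Q → Bool} (h : ∀ j ∈ S, u j = v j) :
    czSign S u = czSign S v := by
  unfold czSign
  congr 1
  exact propext (forall₂_congr fun j hj => by rw [h j hj])

theorem czSign_mul_self (S : Finset Q) (u : Q → Bool) : czSign S u * czSign S u = 1 := by
  unfold czSign
  split_ifs <;> norm_num

/-- The operator applying the `CZ` gates on the sets in a list. -/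
def czProd (l : List (Finset Q)) : QubitOp Q := (l.map czGate).prod

theorem czProd_nil : czProd ([] : List (Finset Q)) = 1 := rfl

theorem czProd_cons (S : Finset Q) (l : List (Finset Q)) :
    czProd (S :: l) = czGate S * czProd l := by
  simp [czProd]

theorem czProd_eq_diagonal (l : List (Finset Q)) :
    czProd l = Matrix.diagonal (l.map czSign).prod := by
  induction l with
  | nil => simp [czProd_nil]
  | cons S l ih =>
    rw [czProd_cons, ih, czGate_eq_diagonal, Matrix.diagonal_mul_diagonal, List.map_cons,
      List.prod_cons]
    rfl

theorem czProd_commute (l l' : List (Finset Q)) : Commute (czProd l) (czProd l') := by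
  rw [czProd_eq_diagonal, czProd_eq_diagonal]
  exact Matrix.commute_diagonal _ _

/-- Used for two splittings of a layer: gates meeting or missing a support, and small or large
gates. -/
theorem czProd_eq_mul_filter (l : List (Finset Q)) (p : Finset Q → Bool) :
    czProd l = czProd (l.filter p) * czProd (l.filter fun S => !p S) := by
  simp only [czProd_eq_diagonal, Matrix.diagonal_mul_diagonal]
  rw [← ((List.filter_append_perm p l).map czSign).prod_eq, List.map_append, List.prod_append]
  rfl

theorem czProd_mul_self (l : List (Finset Q)) : czProd l * czProd l = 1 := by
  rw [czProd_eq_diagonal, Matrix.diagonal_mul_diagonal, ← Matrix.diagonal_one]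
  congr 1
  funext u
  induction l with
  | nil => simp
  | cons S l ih =>
    rw [List.map_cons, List.prod_cons, Pi.mul_apply, mul_mul_mul_comm, czSign_mul_self, one_mul, ih]

theorem czProd_conjTranspose (l : List (Finset Q)) : (czProd l).conjTranspose = czProd l := by
  rw [czProd_eq_diagonal, Matrix.diagonal_conjTranspose]
  congr 1
  funext u
  induction l with
  | nil => simp
  | cons S l ih =>
    rw [Pi.star_apply] at ih ⊢
    rw [List.map_cons, List.prod_cons, Pi.mul_apply, star_mul', ih]
    congr 1
    unfold czSign
    split_ifs <;> simp

theorem czGate_mem_supportedOn (S : Finset Q) : czGate S ∈ supportedOn S := by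
  rw [czGate_eq_diagonal]
  exact diagonal_mem_supportedOn fun u v h => czSign_congr h

theorem commute_czGate {T S : Finset Q} (hTS : Disjoint T S) {A : QubitOp Q}
    (hA : A ∈ supportedOn T) : Commute (czGate S) A := by
  rw [czGate_eq_diagonal]
  exact commute_diagonal_of_mem_supportedOn hTS hA fun u v h => czSign_congr h

theorem czProd_mem_supportedOn {l : List (Finset Q)} {T : Finset Q} (h : ∀ S ∈ l, S ⊆ T) :
    czProd l ∈ supportedOn T := by
  refine list_prod_mem fun A hA => ?_
  obtain ⟨S, hS, rfl⟩ := List.mem_map.1 hA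
  exact supportedOn_mono (h S hS) (czGate_mem_supportedOn S)

theorem commute_czProd {l : List (Finset Q)} {T : Finset Q} (h : ∀ S ∈ l, Disjoint T S)
    {A : QubitOp Q} (hA : A ∈ supportedOn T) : Commute (czProd l) A := by
  refine Commute.list_prod_left _ _ fun B hB => ?_
  obtain ⟨S, hS, rfl⟩ := List.mem_map.1 hB
  exact commute_czGate (h S hS) hA

/-- The light cone of `T` under the gates in `l`. -/
def lightCone (l : List (Finset Q)) (T : Finset Q) : Finset Q :=
  T.biUnion fun i => insert i (Finset.univ.filter fun j => ∃ S ∈ l, i ∈ S ∧ j ∈ S)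

theorem subset_lightCone (l : List (Finset Q)) (T : Finset Q) : T ⊆ lightCone l T := fun i hi =>
  Finset.mem_biUnion.2 ⟨i, hi, Finset.mem_insert_self _ _⟩

theorem gate_subset_lightCone {l : List (Finset Q)} {T S : Finset Q} (hS : S ∈ l)
    (h : ¬ Disjoint T S) : S ⊆ lightCone l T := by
  obtain ⟨i, hiT, hiS⟩ := Finset.not_disjoint_iff.1 h
  refine fun j hj => Finset.mem_biUnion.2 ⟨i, hiT, Finset.mem_insert_of_mem ?_⟩
  simpa using ⟨S, hS, hiS, hj⟩

theorem eq_of_mem_of_pairwise_disjoint {l : List (Finset Q)} (hl : l.Pairwise Disjoint)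
    {S S' : Finset Q} (hS : S ∈ l) (hS' : S' ∈ l) {i : Q} (hi : i ∈ S) (hi' : i ∈ S') :
    S = S' := by
  by_contra hne
  exact Finset.disjoint_left.1 (hl.forall hS hS' hne) hi hi'

/-- By disjointness the cone of one qubit is the single gate through it, or the qubit alone if no
gate contains it; the latter case is where `1 ≤ s` enters. -/
theorem card_lightCone_le {l : List (Finset Q)} (hl : l.Pairwise Disjoint) {s : ℝ} (hs : 1 ≤ s)
    (hcard : ∀ S ∈ l, (S.card : ℝ) ≤ s) (T : Finset Q) :
    ((lightCone l T).card : ℝ) ≤ s * T.card := by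
  have h1 : (lightCone l T).card ≤ T.card * ⌊s⌋₊ := by
    refine Finset.card_biUnion_le_card_mul _ _ _ fun i _ => Nat.le_floor ?_
    by_cases h : ∃ S ∈ l, i ∈ S
    · obtain ⟨S, hS, hi⟩ := h
      refine le_trans ?_ (hcard S hS)
      refine Nat.cast_le.2 (Finset.card_le_card fun j hj => ?_)
      rcases Finset.mem_insert.1 hj with rfl | hj
      · exact hi
      · obtain ⟨S', hS', hi', hj'⟩ := (Finset.mem_filter.1 hj).2
        rwa [eq_of_mem_of_pairwise_disjoint hl hS hS' hi hi']
    · have : (Finset.univ.filter fun j => ∃ S ∈ l, i ∈ S ∧ j ∈ S) = ∅ :=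
        Finset.filter_eq_empty_iff.2 fun j _ ⟨S, hS, hi, _⟩ => h ⟨S, hS, hi⟩
      simpa [this] using hs
  calc ((lightCone l T).card : ℝ) ≤ T.card * (⌊s⌋₊ : ℝ) := mod_cast h1
    _ ≤ T.card * s := by
      gcongr
      exact Nat.floor_le (by linarith)
    _ = s * T.card := mul_comm _ _

/-- Gates disjoint from `T` commute past `A` and cancel against their second copy; the remaining
gates lie inside the light cone. -/
theorem conj_czProd_mem_supportedOn (l : List (Finset Q)) {T : Finset Q} {A : QubitOp Q}
    (hA : A ∈ supportedOn T) : czProd l * A * czProd l ∈ supportedOn (lightCone l T) := by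
  set far := l.filter fun S => decide (Disjoint T S)
  set near := l.filter fun S => !decide (Disjoint T S)
  have hl : czProd l = czProd far * czProd near := czProd_eq_mul_filter l _
  have hfar : Commute (czProd far) A := commute_czProd (T := T) (by simp [far]) hA
  have hnear : czProd near ∈ supportedOn (lightCone l T) := czProd_mem_supportedOn fun S hS => by
    simp only [near, List.mem_filter] at hS
    exact gate_subset_lightCone hS.1 (by simpa using hS.2)
  have hcomm : czProd far * czProd near = czProd near * czProd far := czProd_commute _ _
  have : czProd l * A * czProd l = czProd near * A * czProd near := by
    calc czProd l * A * czProd l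
        = czProd near * (czProd far * A) * (czProd far * czProd near) := by
          rw [hl, hcomm]; simp only [mul_assoc]
      _ = czProd near * A * (czProd far * czProd far) * czProd near := by
          rw [hfar.eq]; simp only [mul_assoc]
      _ = czProd near * A * czProd near := by rw [czProd_mul_self, mul_one]
  rw [this]
  exact mul_mem (mul_mem hnear (supportedOn_mono (subset_lightCone l T) hA)) hnear

theorem conj_czProd_mem_opDegreeLE {l : List (Finset Q)} (hl : l.Pairwise Disjoint) {s : ℝ}
    (hs : 1 ≤ s) (hcard : ∀ S ∈ l, (S.card : ℝ) ≤ s) {r : ℝ} {A : QubitOp Q}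
    (hA : A ∈ opDegreeLE Q r) : czProd l * A * czProd l ∈ opDegreeLE Q (s * r) := by
  rw [← sandwich_apply]
  refine linearMap_mem_opDegreeLE _ (fun T hT A hA => ?_) hA
  rw [sandwich_apply]
  refine mem_opDegreeLE_of_mem_supportedOn (conj_czProd_mem_supportedOn l hA) ?_
  exact (card_lightCone_le hl hs hcard T).trans (by gcongr)

theorem sum_card_le_of_pairwise_disjoint {l : List (Finset Q)} (hl : l.Pairwise Disjoint) :
    (l.map Finset.card).sum ≤ Fintype.card Q := by
  -- The witness is the union of the gates; the disjointness clause lets the induction add a further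
  -- gate.
  suffices h : ∃ T : Finset Q, (l.map Finset.card).sum = T.card ∧ ∀ S, (∀ S' ∈ l, Disjoint S S') →
      Disjoint S T by
    obtain ⟨T, hT, -⟩ := h
    exact hT ▸ Finset.card_le_univ T
  induction l with
  | nil => exact ⟨∅, by simp⟩
  | cons S l ih =>
    obtain ⟨h1, h2⟩ := List.pairwise_cons.1 hl
    obtain ⟨T, hT, hdisj⟩ := ih h2
    refine ⟨S ∪ T, ?_, fun S' hS' => ?_⟩
    · rw [List.map_cons, List.sum_cons, hT, Finset.card_union_of_disjoint (hdisj S h1)]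
    · rw [Finset.disjoint_union_right]
      exact ⟨hS' S (by simp), hdisj S' fun S'' h => hS' S'' (by simp [h])⟩

end CZ

/-! ### Low-degree approximation of `CZ` gates -/

section Approximation

set_option linter.unusedSectionVars false

/-- A polynomial of degree `O(√k Λ)` which is `1` at `k` and at most `2 exp (-Λ)` in absolute value
at the integers `0, …, k - 1`. -/
theorem exists_polynomial_approx_and {k : ℕ} (hk : 1 ≤ k) {Λ : ℝ} (hΛ : 1 ≤ Λ) :
    ∃ p : Polynomial ℝ, (p.natDegree : ℝ) ≤ 2 * √k * Λ ∧ p.eval (k : ℝ) = 1 ∧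
      ∀ j : ℕ, j < k → |p.eval (j : ℝ)| ≤ 2 * Real.exp (-Λ) := by
  have hk' : (1 : ℝ) ≤ k := mod_cast hk
  have hk0 : (0 : ℝ) < k := by linarith
  have hsqrt : 1 ≤ √(k : ℝ) := Real.one_le_sqrt.2 hk'
  set m := ⌈√(k : ℝ) * Λ⌉₊ with hm
  set t := 1 / √(k : ℝ) with ht
  -- This keeps the rescaled points `0, …, k - 1` inside `[-1, 1]`, since `(1 + 1/k)(k - 1) = k -
  -- 1/k`.
  have hcosh : Real.cosh t ≤ 1 + 1 / k := by
    have ht2 : t ^ 2 = 1 / k := by rw [ht, div_pow, Real.sq_sqrt hk0.le, one_pow]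
    have hle : (1 : ℝ) / k ≤ 1 := by rw [div_le_one hk0]; exact hk'
    have h0 : (0 : ℝ) < 1 / k := by positivity
    refine (Real.cosh_le_exp_half_sq t).trans ?_
    rw [ht2]
    have h := Real.exp_bound_div_one_sub_of_interval (x := 1 / (k : ℝ) / 2) (by positivity)
      (by linarith)
    refine h.trans ?_
    rw [div_le_iff₀ (by linarith)]
    nlinarith
  have hmt : Λ ≤ m * t := by
    rw [ht, mul_one_div, le_div_iff₀ (by linarith), mul_comm]
    exact Nat.le_ceil _
  have hden : Real.exp Λ / 2 ≤ (Polynomial.Chebyshev.T ℝ m).eval (Real.cosh t) := by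
    rw [Polynomial.Chebyshev.T_real_cosh, Real.cosh_eq]
    have h1 : Real.exp Λ ≤ Real.exp ((m : ℤ) * t) := Real.exp_le_exp.2 (by exact_mod_cast hmt)
    have h2 := Real.exp_pos (-((m : ℤ) * t))
    linarith
  have hden0 : 0 < (Polynomial.Chebyshev.T ℝ m).eval (Real.cosh t) :=
    lt_of_lt_of_le (by positivity) hden
  refine ⟨Polynomial.C ((Polynomial.Chebyshev.T ℝ m).eval (Real.cosh t))⁻¹ *
    (Polynomial.Chebyshev.T ℝ m).comp (Polynomial.C (Real.cosh t / k) * Polynomial.X), ?_, ?_, ?_⟩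
  · have h1 : (Polynomial.C ((Polynomial.Chebyshev.T ℝ m).eval (Real.cosh t))⁻¹ *
        (Polynomial.Chebyshev.T ℝ m).comp
          (Polynomial.C (Real.cosh t / k) * Polynomial.X)).natDegree ≤ m := by
      refine (Polynomial.natDegree_C_mul_le _ _).trans ?_
      refine Polynomial.natDegree_comp_le.trans ?_
      rw [Polynomial.Chebyshev.natDegree_T, Int.natAbs_natCast]
      calc m * _ ≤ m * 1 := by
            gcongr
            exact (Polynomial.natDegree_C_mul_le _ _).trans Polynomial.natDegree_X_le
        _ = m := mul_one m
    have h2 : (m : ℝ) ≤ √k * Λ + 1 := (Nat.ceil_lt_add_one (by positivity)).le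
    have h3 : 1 ≤ √(k : ℝ) * Λ := by nlinarith
    have h4 := (Nat.cast_le (α := ℝ)).2 h1
    linarith
  · have : Real.cosh t / k * k = Real.cosh t := div_mul_cancel₀ _ hk0.ne'
    simp only [Polynomial.eval_mul, Polynomial.eval_C, Polynomial.eval_comp, Polynomial.eval_X,
      this]
    exact inv_mul_cancel₀ hden0.ne'
  · intro j hj
    simp only [Polynomial.eval_mul, Polynomial.eval_C, Polynomial.eval_comp, Polynomial.eval_X]
    have hjk : (j : ℝ) + 1 ≤ k := mod_cast hj
    have hx : |Real.cosh t / k * j| ≤ 1 := by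
      rw [abs_of_nonneg (by positivity), div_mul_eq_mul_div, div_le_one hk0]
      calc Real.cosh t * j ≤ (1 + 1 / k) * (k - 1) := by
            gcongr
            linarith
        _ = k - 1 / k := by field_simp; ring
        _ ≤ k := by
          have : (0 : ℝ) < 1 / k := by positivity
          linarith
    have hT := Polynomial.Chebyshev.abs_eval_T_real_le_one m hx
    rw [abs_mul, abs_of_pos (inv_pos.2 hden0)]
    calc _ ≤ (Real.exp Λ / 2)⁻¹ * 1 := by gcongr
      _ = 2 * Real.exp (-Λ) := by rw [Real.exp_neg]; field_simp

variable {Q : Type} [Fintype Q] [DecidableEq Q]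

theorem aeval_diagonal (w : (Q → Bool) → ℂ) (p : Polynomial ℂ) :
    Polynomial.aeval (Matrix.diagonal w : QubitOp Q) p = Matrix.diagonal fun u => p.eval (w u) := by
  have h := Polynomial.aeval_algHom_apply (Matrix.diagonalAlgHom (n := Q → Bool) (α := ℂ) ℂ) w p
  rw [Matrix.diagonalAlgHom_apply, Matrix.diagonalAlgHom_apply] at h
  rw [h]
  congr 1
  funext u
  simp

/-- The Hamming weight on the qubits in `S` is an observable of degree one. -/
theorem diagonal_hammingWeight_mem_opDegreeLE (S : Finset Q) :
    (Matrix.diagonal fun u : Q → Bool => ((S.filter fun i => u i = true).card : ℂ)) ∈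
      opDegreeLE Q 1 := by
  have h : (Matrix.diagonal fun u : Q → Bool => ((S.filter fun i => u i = true).card : ℂ)) =
      ∑ i ∈ S, Matrix.diagonal fun u : Q → Bool => if u i = true then (1 : ℂ) else 0 := by
    have : (fun u : Q → Bool => ((S.filter fun i => u i = true).card : ℂ)) =
        ∑ i ∈ S, fun u : Q → Bool => if u i = true then (1 : ℂ) else 0 := by
      funext u
      simp [Finset.sum_apply]
    rw [this]
    exact map_sum (Matrix.diagonalAddMonoidHom (Q → Bool) ℂ) _ _
  rw [h]
  refine Submodule.sum_mem _ fun i _ => mem_opDegreeLE_of_mem_supportedOn (T := {i}) ?_ (by simp)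
  exact diagonal_mem_supportedOn fun u v huv => by rw [huv i (by simp)]

/-- The approximant is `1 - 2p²`, with `p` the Chebyshev approximation of AND evaluated at the
Hamming weight on `S`. Squaring keeps the values in `[-1, 1]`, so that products of approximants stay
bounded; it doubles the degree and gives error `2 · (2 exp (-Λ))²`. -/
theorem exists_approx_czSign {S : Finset Q} (hS : S.Nonempty) {Λ : ℝ} (hΛ : 1 ≤ Λ) :
    ∃ h : (Q → Bool) → ℂ, Matrix.diagonal h ∈ opDegreeLE Q (4 * Λ * √S.card) ∧
      (∀ u, ‖h u‖ ≤ 1) ∧ ∀ u, ‖h u - czSign S u‖ ≤ 8 * Real.exp (-(2 * Λ)) := by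
  obtain ⟨p, hdeg, hp1, hp⟩ := exists_polynomial_approx_and (Finset.card_pos.2 hS) hΛ
  set w : (Q → Bool) → ℕ := fun u => (S.filter fun i => u i = true).card with hw
  set q : Polynomial ℝ := 1 - 2 * p ^ 2 with hq
  have hexp : (2 * Real.exp (-Λ)) ^ 2 = 4 * Real.exp (-(2 * Λ)) := by
    rw [mul_pow, ← Real.exp_nat_mul]
    norm_num
  have hexp1 : (2 * Real.exp (-Λ)) ^ 2 ≤ 1 := by
    have h1 : Real.exp (-Λ) ≤ Real.exp (-1) := Real.exp_le_exp.2 (by linarith)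
    have h2 : Real.exp (-1) ≤ 1 / 2 := by
      rw [Real.exp_neg, inv_eq_one_div]
      have := Real.add_one_le_exp (1 : ℝ)
      gcongr
      linarith
    have h3 := Real.exp_pos (-Λ)
    nlinarith
  have hqeval : ∀ x : ℝ, q.eval x = 1 - 2 * (p.eval x) ^ 2 := fun x => by simp [hq]
  have hvals : ∀ u, (czSign S u = -1 ∧ q.eval (w u : ℝ) = -1) ∨
      (czSign S u = 1 ∧ (p.eval (w u : ℝ)) ^ 2 ≤ (2 * Real.exp (-Λ)) ^ 2) := by
    intro u
    by_cases h : ∀ i ∈ S, u i = true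
    · left
      have : w u = S.card := by rw [hw]; simp only [Finset.filter_true_of_mem h]
      rw [hqeval, this, hp1]
      refine ⟨if_pos h, by norm_num⟩
    · right
      refine ⟨if_neg h, ?_⟩
      have hlt : w u < S.card := by
        refine Finset.card_lt_card (Finset.filter_ssubset.2 ?_)
        push Not at h
        exact h
      exact sq_le_sq' (by linarith [(abs_le.1 (hp _ hlt)).1]) (abs_le.1 (hp _ hlt)).2
  refine ⟨fun u => ((q.eval (w u : ℝ) : ℝ) : ℂ), ?_, fun u => ?_, fun u => ?_⟩
  · have h := aeval_mem_opDegreeLE (diagonal_hammingWeight_mem_opDegreeLE S)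
      (q.map (algebraMap ℝ ℂ))
    rw [aeval_diagonal] at h
    have heq : (fun u : Q → Bool => ((q.eval (w u : ℝ) : ℝ) : ℂ)) =
        fun u => (q.map (algebraMap ℝ ℂ)).eval ((S.filter fun i => u i = true).card : ℂ) := by
      funext u
      have := Polynomial.eval_map_algebraMap (B := ℂ) q ((w u : ℝ) : ℂ)
      have h2 := Polynomial.aeval_algebraMap_apply ℂ (w u : ℝ) q
      simp only [Complex.coe_algebraMap, Polynomial.coe_aeval_eq_eval] at h2 this
      rw [← h2, ← this]
      simp [hw]
    rw [heq]
    refine opDegreeLE_mono ?_ h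
    rw [Polynomial.natDegree_map]
    have hdeg' : q.natDegree ≤ 2 * p.natDegree := by
      refine (Polynomial.natDegree_sub_le _ _).trans ?_
      rw [Polynomial.natDegree_one]
      refine max_le (Nat.zero_le _) ?_
      refine Polynomial.natDegree_mul_le.trans ?_
      have : (2 : Polynomial ℝ).natDegree = 0 := Polynomial.natDegree_ofNat 2
      rw [this, zero_add]
      exact Polynomial.natDegree_pow_le
    have : (q.natDegree : ℝ) ≤ 2 * p.natDegree := mod_cast hdeg'
    linarith
  · rw [Complex.norm_real, Real.norm_eq_abs, abs_le]
    rcases hvals u with ⟨-, h⟩ | ⟨-, h⟩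
    · rw [h]; norm_num
    · rw [hqeval]
      constructor <;> nlinarith [sq_nonneg (p.eval (w u : ℝ))]
  · rcases hvals u with ⟨h1, h⟩ | ⟨h1, h⟩
    · simp only [h1, h]
      simp
      positivity
    · rw [h1]
      dsimp only
      rw [hqeval]
      have : ((1 - 2 * (p.eval (w u : ℝ)) ^ 2 : ℝ) : ℂ) - 1 =
          ((-(2 * (p.eval (w u : ℝ)) ^ 2) : ℝ) : ℂ) := by
        push_cast; ring
      rw [this, Complex.norm_real, norm_neg, Real.norm_of_nonneg (by positivity)]
      linarith

/-- Since all factors have absolute value at most one, telescoping makes the errors add up; the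
degrees add as well. -/
theorem exists_approx_czProd {l : List (Finset Q)} (hl : ∀ S ∈ l, S.Nonempty) {Λ : ℝ}
    (hΛ : 1 ≤ Λ) :
    ∃ h : (Q → Bool) → ℂ,
      Matrix.diagonal h ∈ opDegreeLE Q (4 * Λ * (l.map fun S => √(S.card : ℝ)).sum) ∧
      (∀ u, ‖h u‖ ≤ 1) ∧
      ∀ u, ‖h u - (l.map czSign).prod u‖ ≤ l.length * (8 * Real.exp (-(2 * Λ))) := by
  induction l with
  | nil => exact ⟨1, by simpa using one_mem_opDegreeLE le_rfl, by simp, by simp⟩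
  | cons S l ih =>
    obtain ⟨g, hg1, hg2, hg3⟩ := ih fun S' hS' => hl S' (by simp [hS'])
    obtain ⟨h, hh1, hh2, hh3⟩ := exists_approx_czSign (hl S (by simp)) hΛ
    refine ⟨h * g, ?_, fun u => ?_, fun u => ?_⟩
    · have := mul_mem_opDegreeLE hh1 hg1
      rw [Matrix.diagonal_mul_diagonal] at this
      rw [List.map_cons, List.sum_cons, mul_add]
      exact this
    · rw [Pi.mul_apply, norm_mul]
      exact mul_le_one₀ (hh2 u) (norm_nonneg _) (hg2 u)
    · have hsign : ‖czSign S u‖ = 1 := by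
        unfold czSign
        split_ifs <;> simp
      rw [List.map_cons, List.prod_cons, Pi.mul_apply, Pi.mul_apply]
      have : h u * g u - czSign S u * (l.map czSign).prod u =
          (h u - czSign S u) * g u + czSign S u * (g u - (l.map czSign).prod u) := by ring
      rw [this, List.length_cons, Nat.cast_succ]
      refine (norm_add_le _ _).trans ?_
      rw [norm_mul, norm_mul, hsign, one_mul, add_mul, one_mul, add_comm]
      refine add_le_add (hg3 u) ?_
      calc _ ≤ (8 * Real.exp (-(2 * Λ))) * 1 :=
            mul_le_mul (hh3 u) (hg2 u) (norm_nonneg _) (by positivity)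
        _ = _ := mul_one _

end Approximation

/-! ### Low-degree approximation of Heisenberg-evolved observables -/

section Circuit

set_option linter.unusedSectionVars false

open scoped Matrix.Norms.L2Operator

variable {Q : Type} [Fintype Q] [DecidableEq Q]

theorem norm_conjTranspose_mul_mul_le {U : QubitOp Q} (hU : ‖U‖ ≤ 1) (A : QubitOp Q) :
    ‖U.conjTranspose * A * U‖ ≤ ‖A‖ := by
  calc ‖U.conjTranspose * A * U‖ ≤ ‖U.conjTranspose‖ * ‖A‖ * ‖U‖ :=
        (norm_mul_le _ _).trans (by gcongr; exact norm_mul_le _ _)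
    _ ≤ 1 * ‖A‖ * 1 := by
        rw [Matrix.l2_opNorm_conjTranspose]
        gcongr
    _ = ‖A‖ := by ring

theorem norm_le_one_of_conjTranspose_mul_self {U : QubitOp Q} (hU : U.conjTranspose * U = 1) :
    ‖U‖ ≤ 1 := by
  have h := Matrix.l2_opNorm_conjTranspose_mul_self U
  rw [hU] at h
  have h1 : ‖(1 : QubitOp Q)‖ ≤ 1 := by
    rw [← Matrix.diagonal_one, Matrix.l2_opNorm_diagonal]
    exact (pi_norm_le_iff_of_nonneg zero_le_one).2 fun u => by simp
  nlinarith [norm_nonneg U]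

theorem norm_singleQubitLayer_le (V : Q → Matrix.unitaryGroup Bool ℂ) :
    ‖singleQubitLayer V‖ ≤ 1 :=
  norm_le_one_of_conjTranspose_mul_self (singleQubitLayer_conjTranspose_mul V)

theorem norm_czProd_le (l : List (Finset Q)) : ‖czProd l‖ ≤ 1 :=
  norm_le_one_of_conjTranspose_mul_self (by rw [czProd_conjTranspose, czProd_mul_self])

/-- For `|S| ≥ s` one has `√|S| ≤ |S| / √s`, and the sizes of disjoint gates sum to at most the
number of qubits. -/
theorem sum_sqrt_card_le {l : List (Finset Q)} (hl : l.Pairwise Disjoint) {s : ℝ} (hs : 1 ≤ s)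
    (hcard : ∀ S ∈ l, s ≤ (S.card : ℝ)) :
    (l.map fun S => √(S.card : ℝ)).sum ≤ Fintype.card Q / √s := by
  have hs0 : 0 < √s := Real.sqrt_pos.2 (by linarith)
  have h1 : (l.map fun S => √(S.card : ℝ)).sum ≤ (l.map fun S => (S.card : ℝ) / √s).sum := by
    refine List.sum_le_sum fun S hS => ?_
    rw [le_div_iff₀ hs0]
    calc √(S.card : ℝ) * √s ≤ √(S.card : ℝ) * √(S.card : ℝ) := by
          gcongr
          exact hcard S hS
      _ = S.card := Real.mul_self_sqrt (Nat.cast_nonneg _)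
  have h2 : (l.map fun S => (S.card : ℝ) / √s).sum = ((l.map Finset.card).sum : ℕ) / √s := by
    clear h1 hl hcard
    induction l with
    | nil => simp
    | cons S l ih => simp only [List.map_cons, List.sum_cons, ih, Nat.cast_add, add_div]
  rw [h2] at h1
  refine h1.trans ?_
  gcongr
  exact sum_card_le_of_pairwise_disjoint hl

/-- Conjugation by a layer of disjoint gates of size at least `s` can be approximated at the cost of
an additive increase of the degree. -/
theorem exists_approx_conj_czProd {l : List (Finset Q)} (hl : l.Pairwise Disjoint) {s : ℝ}
    (hs : 1 ≤ s) (hcard : ∀ S ∈ l, s ≤ (S.card : ℝ)) {Λ : ℝ} (hΛ : 1 ≤ Λ) {r η : ℝ}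
    {A B : QubitOp Q} (hA : ‖A‖ ≤ 1) (hB : B ∈ opDegreeLE Q r) (hAB : ‖A - B‖ ≤ η) :
    ∃ B' ∈ opDegreeLE Q (r + 8 * Λ * (Fintype.card Q / √s)),
      ‖czProd l * A * czProd l - B'‖ ≤
        η + 2 * (Fintype.card Q * (8 * Real.exp (-(2 * Λ)))) := by
  have hne : ∀ S ∈ l, S.Nonempty := fun S hS => by
    have h := hs.trans (hcard S hS)
    exact Finset.card_pos.1 (by exact_mod_cast lt_of_lt_of_le zero_lt_one h)
  obtain ⟨h, hh1, hh2, hh3⟩ := exists_approx_czProd hne hΛ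
  set D : QubitOp Q := Matrix.diagonal h
  have hlen : (l.length : ℝ) ≤ Fintype.card Q := by
    refine le_trans (Nat.cast_le.2 ?_) (Nat.cast_le.2 (sum_card_le_of_pairwise_disjoint hl))
    have := List.card_nsmul_le_sum (l.map Finset.card) 1 (by
      intro k hk
      obtain ⟨S, hS, rfl⟩ := List.mem_map.1 hk
      exact Finset.card_pos.2 (hne S hS))
    simpa using this
  have hDle : ‖D‖ ≤ 1 := by
    rw [Matrix.l2_opNorm_diagonal]
    exact (pi_norm_le_iff_of_nonneg zero_le_one).2 hh2
  set ε : ℝ := Fintype.card Q * (8 * Real.exp (-(2 * Λ))) with hε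
  have hDU : ‖D - czProd l‖ ≤ ε := by
    rw [czProd_eq_diagonal, Matrix.diagonal_sub, Matrix.l2_opNorm_diagonal]
    refine (pi_norm_le_iff_of_nonneg (by positivity)).2 fun u => (hh3 u).trans ?_
    rw [hε]
    gcongr
  refine ⟨D * B * D, ?_, ?_⟩
  · refine opDegreeLE_mono ?_ (mul_mem_opDegreeLE (mul_mem_opDegreeLE hh1 hB) hh1)
    have := mul_le_mul_of_nonneg_left (sum_sqrt_card_le hl hs hcard)
      (show 0 ≤ 8 * Λ by linarith)
    linarith
  · set U := czProd l
    have hU : ‖U‖ ≤ 1 := norm_czProd_le l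
    -- The terms are arranged so that only the norms of `A`, `D` and `U` enter: no bound on `‖B‖` is
    -- needed.
    have key : U * A * U - D * B * D =
        D * (A - B) * D - (D - U) * A * U - D * A * (D - U) := by noncomm_ring
    rw [key]
    have h1 : ‖D * (A - B) * D‖ ≤ η := by
      calc _ ≤ ‖D‖ * ‖A - B‖ * ‖D‖ := (norm_mul_le _ _).trans (by gcongr; exact norm_mul_le _ _)
        _ ≤ 1 * η * 1 := by
          have : 0 ≤ η := (norm_nonneg _).trans hAB
          gcongr
        _ = η := by ring
    have h2 : ‖(D - U) * A * U‖ ≤ ε := by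
      calc _ ≤ ‖D - U‖ * ‖A‖ * ‖U‖ := (norm_mul_le _ _).trans (by gcongr; exact norm_mul_le _ _)
        _ ≤ ε * 1 * 1 := by gcongr
        _ = ε := by ring
    have h3 : ‖D * A * (D - U)‖ ≤ ε := by
      calc _ ≤ ‖D‖ * ‖A‖ * ‖D - U‖ := (norm_mul_le _ _).trans (by gcongr; exact norm_mul_le _ _)
        _ ≤ 1 * 1 * ε := by gcongr
        _ = ε := by ring
    have h4 := norm_sub_le (D * (A - B) * D - (D - U) * A * U) (D * A * (D - U))
    have h5 := norm_sub_le (D * (A - B) * D) ((D - U) * A * U)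
    linarith

/-- Conjugation by a layer of `CZ` gates: the gates of size at most `s` multiply the degree by `s`,
the others are approximated. -/
theorem exists_approx_conj_czLayer (M : CZLayer Q) {s : ℝ} (hs : 1 ≤ s) {Λ : ℝ} (hΛ : 1 ≤ Λ)
    {r η : ℝ} {A B : QubitOp Q} (hA : ‖A‖ ≤ 1) (hB : B ∈ opDegreeLE Q r) (hAB : ‖A - B‖ ≤ η) :
    ∃ B' ∈ opDegreeLE Q (s * r + 8 * Λ * (Fintype.card Q / √s)),
      ‖M.toOp * A * M.toOp - B'‖ ≤
        η + 2 * (Fintype.card Q * (8 * Real.exp (-(2 * Λ)))) := by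
  classical
  set small := M.gates.filter fun S => decide ((S.card : ℝ) ≤ s)
  set large := M.gates.filter fun S => !decide ((S.card : ℝ) ≤ s)
  have hM : M.toOp = czProd small * czProd large := czProd_eq_mul_filter M.gates _
  have hcomm : czProd small * czProd large = czProd large * czProd small := czProd_commute _ _
  have hsmall : czProd small * B * czProd small ∈ opDegreeLE Q (s * r) :=
    conj_czProd_mem_opDegreeLE (M.disjoint.filter _) hs
      (fun S hS => by simpa using (List.mem_filter.1 hS).2) hB
  have hconj : ∀ X : QubitOp Q, ‖czProd small * X * czProd small‖ ≤ ‖X‖ := fun X => by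
    simpa [czProd_conjTranspose] using norm_conjTranspose_mul_mul_le (norm_czProd_le small) X
  obtain ⟨B', hB', h⟩ := exists_approx_conj_czProd (M.disjoint.filter _) hs
    (l := large) (η := η) (fun S hS => by
      have := (List.mem_filter.1 hS).2
      simp only [Bool.not_eq_true', decide_eq_false_iff_not, not_le] at this
      exact this.le) hΛ ((hconj A).trans hA) hsmall
    (by rw [← sub_mul, ← mul_sub]; exact (hconj _).trans hAB)
  refine ⟨B', hB', ?_⟩
  -- The small gates act on the observable first, so the additive cost of the large gates is not
  -- multiplied by `s`.
  have : M.toOp * A * M.toOp =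
      czProd large * (czProd small * A * czProd small) * czProd large := by
    rw [hM]
    nth_rewrite 1 [hcomm]
    simp only [mul_assoc]
  rwa [this]

theorem CZLayer.toOp_conjTranspose (M : CZLayer Q) : M.toOp.conjTranspose = M.toOp :=
  czProd_conjTranspose M.gates

theorem CZLayer.toOp_mul_self (M : CZLayer Q) : M.toOp * M.toOp = 1 := czProd_mul_self M.gates

theorem QACCircuit.toOp_conjTranspose_mul {d : ℕ} (U : QACCircuit Q d) :
    U.toOp.conjTranspose * U.toOp = 1 := by
  induction U with
  | base V => exact singleQubitLayer_conjTranspose_mul V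
  | step U M V ih =>
    simp only [QACCircuit.toOp, Matrix.conjTranspose_mul, CZLayer.toOp_conjTranspose]
    calc _ = U.toOp.conjTranspose * (M.toOp * ((singleQubitLayer V).conjTranspose *
          singleQubitLayer V) * M.toOp) * U.toOp := by simp only [mul_assoc]
      _ = 1 := by
        rw [singleQubitLayer_conjTranspose_mul, mul_one, CZLayer.toOp_mul_self, mul_one, ih]

/-- An observable which is approximated by one of degree about `N ^ (1 - 3 ^ (-j))` evolves under a
circuit of depth `d` to one which is approximated by one of degree about `N ^ (1 - 3 ^ (-(j+d)))`,
where `N` is the number of qubits. -/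
theorem exists_approx_heisenberg {Λ : ℝ} (hΛ : 1 ≤ Λ) (hQ : 1 ≤ Fintype.card Q) {d : ℕ}
    (U : QACCircuit Q d) : ∀ (j : ℕ) {η : ℝ} {A B : QubitOp Q}, ‖A‖ ≤ 1 → ‖A - B‖ ≤ η →
    B ∈ opDegreeLE Q ((1 + 8 * Λ * j) * (Fintype.card Q : ℝ) ^ (1 - (1 / 3 : ℝ) ^ j)) →
    ∃ B' ∈ opDegreeLE Q ((1 + 8 * Λ * (j + d : ℕ)) *
        (Fintype.card Q : ℝ) ^ (1 - (1 / 3 : ℝ) ^ (j + d))),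
      ‖U.toOp.conjTranspose * A * U.toOp - B'‖ ≤
        η + d * (2 * (Fintype.card Q * (8 * Real.exp (-(2 * Λ))))) := by
  have hlayer : ∀ (V : Q → Matrix.unitaryGroup Bool ℂ) {η : ℝ} {A B : QubitOp Q}, ‖A - B‖ ≤ η →
      ‖(singleQubitLayer V).conjTranspose * A * singleQubitLayer V -
        (singleQubitLayer V).conjTranspose * B * singleQubitLayer V‖ ≤ η := by
    intro V η A B hAB
    rw [← sub_mul, ← mul_sub]
    exact (norm_conjTranspose_mul_mul_le (norm_singleQubitLayer_le V) _).trans hAB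
  have hN : (1 : ℝ) ≤ Fintype.card Q := mod_cast hQ
  have hN0 : (0 : ℝ) < Fintype.card Q := by linarith
  -- The outermost layer meets the observable first and raises its level from `j` to `j + 1`, so the
  -- induction hypothesis for the inner circuit must hold at every `j`, `A` and `B`.
  induction U with
  | base V =>
    intro j η A B hA hAB hB
    exact ⟨_, conj_singleQubitLayer_mem_opDegreeLE hB V, (hlayer V hAB).trans (by simp)⟩
  | @step d U M V ih =>
    intro j η A B hA hAB hB
    set N : ℝ := (Fintype.card Q : ℝ) with hNdef
    -- With threshold `s = N ^ (2t)` and `3⁻ʲ = 3t`, both `s · N ^ (1 - 3t)` and `N / √s` equal `N ^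
    -- (1 - t)`.
    set t : ℝ := (1 / 3) ^ (j + 1) with ht
    have hs : 1 ≤ N ^ (2 * t) := Real.one_le_rpow hN (by positivity)
    obtain ⟨B₁, hB₁, h₁⟩ := exists_approx_conj_czLayer M hs hΛ
      ((norm_conjTranspose_mul_mul_le (norm_singleQubitLayer_le V) A).trans hA)
      (conj_singleQubitLayer_mem_opDegreeLE hB V) (hlayer V hAB)
    have hdeg : N ^ (2 * t) * ((1 + 8 * Λ * j) * N ^ (1 - (1 / 3 : ℝ) ^ j)) +
        8 * Λ * (N / √(N ^ (2 * t))) =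
        (1 + 8 * Λ * (j + 1 : ℕ)) * N ^ (1 - (1 / 3 : ℝ) ^ (j + 1)) := by
      have e1 : N ^ (2 * t) * N ^ (1 - (1 / 3 : ℝ) ^ j) = N ^ (1 - t) := by
        rw [← Real.rpow_add hN0]
        congr 1
        rw [ht, pow_succ]
        ring
      have e2 : N / √(N ^ (2 * t)) = N ^ (1 - t) := by
        rw [Real.sqrt_eq_rpow, ← Real.rpow_mul hN0.le, Real.rpow_sub hN0, Real.rpow_one]
        congr 2
        ring
      rw [e2, mul_left_comm, e1]
      push_cast
      ring
    rw [hdeg] at hB₁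
    have hA₁ : ‖M.toOp * ((singleQubitLayer V).conjTranspose * A * singleQubitLayer V) *
        M.toOp‖ ≤ 1 := by
      have := norm_conjTranspose_mul_mul_le (norm_czProd_le M.gates)
        ((singleQubitLayer V).conjTranspose * A * singleQubitLayer V)
      rw [czProd_conjTranspose] at this
      exact this.trans ((norm_conjTranspose_mul_mul_le (norm_singleQubitLayer_le V) A).trans hA)
    obtain ⟨B', hB', h'⟩ := ih (j + 1) hA₁ h₁ hB₁
    refine ⟨B', ?_, ?_⟩
    · rwa [show j + (d + 1) = j + 1 + d by ring]
    · have : (QACCircuit.step U M V).toOp.conjTranspose * A * (QACCircuit.step U M V).toOp =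
          U.toOp.conjTranspose *
            (M.toOp * ((singleQubitLayer V).conjTranspose * A * singleQubitLayer V) * M.toOp) *
            U.toOp := by
        simp only [QACCircuit.toOp, Matrix.conjTranspose_mul, CZLayer.toOp_conjTranspose, mul_assoc]
      rw [this]
      refine h'.trans (le_of_eq ?_)
      push_cast
      ring

end Circuit

/-! ### The degree filtration on functions on the Boolean cube -/

section Cube

variable {n : ℕ}

/-- The functions of degree at most `r`: linear combinations of functions of at most `r` of the
variables. -/
def cubeDegreeLE (n : ℕ) (r : ℝ) : Submodule ℝ ((Fin n → Bool) → ℝ) :=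
  Submodule.span ℝ {g | ∃ T : Finset (Fin n), (T.card : ℝ) ≤ r ∧
    ∀ x y, (∀ i ∈ T, x i = y i) → g x = g y}

theorem cubeDegreeLE_mono {r r' : ℝ} (h : r ≤ r') : cubeDegreeLE n r ≤ cubeDegreeLE n r' :=
  Submodule.span_mono fun _ ⟨T, hT, hg⟩ => ⟨T, hT.trans h, hg⟩

theorem mem_cubeDegreeLE {g : (Fin n → Bool) → ℝ} {T : Finset (Fin n)} {r : ℝ}
    (hT : (T.card : ℝ) ≤ r) (hg : ∀ x y, (∀ i ∈ T, x i = y i) → g x = g y) :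
    g ∈ cubeDegreeLE n r :=
  Submodule.subset_span ⟨T, hT, hg⟩

theorem mul_mem_cubeDegreeLE {r r' : ℝ} {g g' : (Fin n → Bool) → ℝ} (hg : g ∈ cubeDegreeLE n r)
    (hg' : g' ∈ cubeDegreeLE n r') : g * g' ∈ cubeDegreeLE n (r + r') := by
  have h := Submodule.mul_mem_mul hg hg'
  rw [cubeDegreeLE, cubeDegreeLE, Submodule.span_mul_span] at h
  refine Submodule.span_le.2 ?_ h
  rintro _ ⟨g, ⟨T, hT, hg⟩, g', ⟨T', hT', hg'⟩, rfl⟩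
  refine mem_cubeDegreeLE (T := T ∪ T') ?_ fun x y hxy => ?_
  · have : ((T ∪ T').card : ℝ) ≤ T.card + T'.card := mod_cast Finset.card_union_le T T'
    linarith
  · simp only [Pi.mul_apply]
    rw [hg x y fun i hi => hxy i (Finset.mem_union_left _ hi),
      hg' x y fun i hi => hxy i (Finset.mem_union_right _ hi)]

theorem aeval_mem_cubeDegreeLE {r : ℝ} (hr : 0 ≤ r) {g : (Fin n → Bool) → ℝ}
    (hg : g ∈ cubeDegreeLE n r) (p : Polynomial ℝ) :
    Polynomial.aeval g p ∈ cubeDegreeLE n (p.natDegree * r) := by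
  have hpow : ∀ k : ℕ, g ^ k ∈ cubeDegreeLE n (k * r) := by
    intro k
    induction k with
    | zero => exact mem_cubeDegreeLE (T := ∅) (by simp) (by simp)
    | succ k ih =>
      rw [pow_succ, Nat.cast_succ, add_mul, one_mul]
      exact mul_mem_cubeDegreeLE ih hg
  rw [Polynomial.aeval_eq_sum_range]
  refine Submodule.sum_mem _ fun k hk => Submodule.smul_mem _ _ ?_
  refine cubeDegreeLE_mono ?_ (hpow k)
  have : k ≤ p.natDegree := Nat.lt_succ_iff.1 (Finset.mem_range.1 hk)
  gcongr

/-- Flipping a coordinate in `S` but not in `T` preserves `g` and negates the character, so the sum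
equals its own negative. -/
theorem fourierCoefficient_eq_zero {g : (Fin n → Bool) → ℝ} {T S : Finset (Fin n)}
    (hg : ∀ x y, (∀ i ∈ T, x i = y i) → g x = g y) (hS : ¬ S ⊆ T) :
    fourierCoefficient g S = 0 := by
  obtain ⟨i, hiS, hiT⟩ := Finset.not_subset.1 hS
  have hinv : Function.Involutive fun x : Fin n → Bool => Function.update x i (!x i) := by
    intro x
    simp
  have hchar : ∀ x : Fin n → Bool,
      cubeCharacter S (Function.update x i (!x i)) = -cubeCharacter S x := by
    intro x
    unfold cubeCharacter
    rw [← Finset.mul_prod_erase _ _ hiS, ← Finset.mul_prod_erase _ _ hiS, ← neg_mul]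
    congr 1
    · cases hx : x i <;> simp
    · refine Finset.prod_congr rfl fun j hj => ?_
      rw [Function.update_of_ne (Finset.ne_of_mem_erase hj)]
  have hsum : ∑ x, g x * cubeCharacter S x = -∑ x, g x * cubeCharacter S x := by
    rw [← Finset.sum_neg_distrib]
    refine Fintype.sum_equiv hinv.toPerm _ _ fun x => ?_
    rw [Function.Involutive.coe_toPerm, hchar,
      hg x (Function.update x i (!x i)) fun j hj => by
        rw [Function.update_of_ne fun h : j = i => hiT (h ▸ hj)]]
    ring
  rw [fourierCoefficient, show ∑ x, g x * cubeCharacter S x = 0 by linarith, zero_div]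

/-- The Fourier coefficient as a linear map. -/
noncomputable def fourierCoefficientLinear (S : Finset (Fin n)) : ((Fin n → Bool) → ℝ) →ₗ[ℝ] ℝ where
  toFun g := fourierCoefficient g S
  map_add' g g' := by
    simp only [fourierCoefficient, Pi.add_apply, add_mul, Finset.sum_add_distrib, add_div]
  map_smul' c g := by
    simp only [fourierCoefficient, Pi.smul_apply, smul_eq_mul, mul_assoc, ← Finset.mul_sum,
      mul_div_assoc, RingHom.id_apply]

theorem fourierDegree_le {r : ℝ} (hr : 0 ≤ r) {g : (Fin n → Bool) → ℝ}
    (hg : g ∈ cubeDegreeLE n r) : (fourierDegree g : ℝ) ≤ r := by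
  classical
  suffices h : fourierDegree g ≤ ⌊r⌋₊ from (Nat.cast_le.2 h).trans (Nat.floor_le hr)
  refine Finset.sup_le fun S hS => ?_
  by_contra hcard
  push Not at hcard
  have hle : cubeDegreeLE n r ≤ LinearMap.ker (fourierCoefficientLinear S) := by
    refine Submodule.span_le.2 ?_
    rintro g ⟨T, hT, hg⟩
    refine LinearMap.mem_ker.2 (fourierCoefficient_eq_zero hg fun hST => ?_)
    have h1 := (Nat.floor_lt hr).1 hcard
    have h2 : (S.card : ℝ) ≤ T.card := mod_cast Finset.card_le_card hST
    linarith
  exact (Finset.mem_filter.1 hS).2 (LinearMap.mem_ker.1 (hle hg))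

/-- The sum over `S` expands a product over `i` whose factors are `2` where `x` and `y` agree and
`0` where they differ. -/
theorem sum_cubeCharacter_mul (x y : Fin n → Bool) :
    ∑ S : Finset (Fin n), cubeCharacter S x * cubeCharacter S y = if x = y then 2 ^ n else 0 := by
  have h : ∀ S : Finset (Fin n), cubeCharacter S x * cubeCharacter S y =
      ∏ i ∈ S, ((if x i then (-1 : ℝ) else 1) * if y i then (-1 : ℝ) else 1) := fun S =>
    Finset.prod_mul_distrib.symm
  simp only [h]
  rw [← Finset.powerset_univ, ← Finset.prod_one_add]
  split_ifs with hxy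
  · subst hxy
    rw [Finset.prod_congr rfl (g := fun _ => (2 : ℝ)) fun i _ => by split_ifs <;> norm_num]
    simp
  · obtain ⟨i, hi⟩ := Function.ne_iff.1 hxy
    refine Finset.prod_eq_zero (Finset.mem_univ i) ?_
    cases hx : x i <;> cases hy : y i <;> simp_all

theorem fourier_inversion (g : (Fin n → Bool) → ℝ) :
    g = ∑ S : Finset (Fin n), fourierCoefficient g S • cubeCharacter S := by
  funext x
  simp only [Finset.sum_apply, Pi.smul_apply, smul_eq_mul, fourierCoefficient, div_mul_eq_mul_div,
    Finset.sum_mul, ← Finset.sum_div]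
  rw [Finset.sum_comm, eq_div_iff (by positivity)]
  simp only [mul_assoc, ← Finset.mul_sum, sum_cubeCharacter_mul]
  simp

/-- Converse of `fourierDegree_le`; amplification needs it to pass from an optimal approximant to
polynomials in it. -/
theorem mem_cubeDegreeLE_fourierDegree (g : (Fin n → Bool) → ℝ) :
    g ∈ cubeDegreeLE n (fourierDegree g) := by
  classical
  have h : ∑ S : Finset (Fin n), fourierCoefficient g S • cubeCharacter S ∈
      cubeDegreeLE n (fourierDegree g) := by
    refine Submodule.sum_mem _ fun S _ => ?_
    by_cases hS : fourierCoefficient g S = 0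
    · rw [hS, zero_smul]
      exact Submodule.zero_mem _
    · refine Submodule.smul_mem _ _ (mem_cubeDegreeLE (T := S) (Nat.cast_le.2 ?_) ?_)
      · exact Finset.le_sup (f := Finset.card) (Finset.mem_filter.2 ⟨Finset.mem_univ S, hS⟩)
      · exact fun x y hxy => Finset.prod_congr rfl fun i hi => by rw [hxy i hi]
  rwa [← fourier_inversion g] at h

theorem fourierDegree_le_card (g : (Fin n → Bool) → ℝ) : fourierDegree g ≤ n := by
  refine Finset.sup_le fun S _ => ?_
  simpa using Finset.card_le_univ S

theorem approxDegree_le {ε : ℝ} {f g : (Fin n → Bool) → ℝ} (h : ∀ x, |f x - g x| ≤ ε) :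
    approxDegree ε f ≤ fourierDegree g :=
  Nat.sInf_le ⟨g, h, rfl⟩

theorem approxDegree_le_card {ε : ℝ} (hε : 0 ≤ ε) (f : (Fin n → Bool) → ℝ) :
    approxDegree ε f ≤ n :=
  (approxDegree_le (g := f) fun x => by simpa using hε).trans (fourierDegree_le_card f)

theorem exists_fourierDegree_eq_approxDegree {ε : ℝ} (hε : 0 ≤ ε) (f : (Fin n → Bool) → ℝ) :
    ∃ g : (Fin n → Bool) → ℝ, (∀ x, |f x - g x| ≤ ε) ∧ fourierDegree g = approxDegree ε f :=
  Nat.sInf_mem (s := {m : ℕ | ∃ g : (Fin n → Bool) → ℝ, (∀ x, |f x - g x| ≤ ε) ∧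
    fourierDegree g = m}) ⟨_, f, fun x => by simpa using hε, rfl⟩

/-- Amplification: for Boolean functions, an error below `1/2` can be decreased to `1/3` at the cost
of a constant factor in the degree. -/
theorem exists_amplification {ε : ℝ} (hε0 : 0 ≤ ε) (hε : ε < 1 / 2) :
    ∃ R : ℕ, 1 ≤ R ∧ ∀ (n : ℕ) (f : (Fin n → Bool) → Bool),
      (approxDegree (1 / 3) (boolToReal f) : ℝ) ≤ R * approxDegree ε (boolToReal f) := by
  -- A continuous clamp equal to `0` up to `ε` and to `1` from `1 - ε` on. A Weierstrass
  -- approximation of it on `[-1, 2]`, an interval containing all values of `g`, is composed with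
  -- `g`.
  set F : ℝ → ℝ := fun t => max 0 (min 1 ((t - ε) / (1 - 2 * ε))) with hF
  have hFc : Continuous F := by fun_prop
  have hden : 0 < 1 - 2 * ε := by linarith
  obtain ⟨p, hp⟩ := exists_polynomial_near_of_continuousOn (-1) 2 F hFc.continuousOn (1 / 3)
    (by norm_num)
  refine ⟨p.natDegree + 1, by omega, fun n f => ?_⟩
  obtain ⟨g, hg, hdeg⟩ := exists_fourierDegree_eq_approxDegree hε0 (boolToReal f)
  have happ : ∀ x, (Polynomial.aeval g p) x = p.eval (g x) := fun x => by simp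
  have h1 : approxDegree (1 / 3) (boolToReal f) ≤ fourierDegree (Polynomial.aeval g p) := by
    refine approxDegree_le fun x => ?_
    have hx := abs_le.1 (hg x)
    have hmem : g x ∈ Set.Icc (-1 : ℝ) 2 := by
      unfold boolToReal at hx
      split_ifs at hx <;> constructor <;> linarith
    have hFx : F (g x) = boolToReal f x := by
      rw [hF]
      unfold boolToReal at hx ⊢
      dsimp only
      split_ifs at hx ⊢
      · rw [min_eq_left, max_eq_right zero_le_one]
        rw [le_div_iff₀ hden]
        linarith
      · rw [max_eq_left]
        refine (min_le_right _ _).trans (div_nonpos_of_nonpos_of_nonneg (by linarith) hden.le)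
    have := hp _ hmem
    rw [hFx, ← happ, abs_sub_comm] at this
    exact this.le
  have h2 := fourierDegree_le (by positivity) (aeval_mem_cubeDegreeLE (Nat.cast_nonneg _)
    (mem_cubeDegreeLE_fourierDegree g) p)
  have h3 : (approxDegree (1 / 3) (boolToReal f) : ℝ) ≤ fourierDegree (Polynomial.aeval g p) :=
    mod_cast h1
  rw [hdeg] at h2
  push_cast
  have : (0 : ℝ) ≤ approxDegree ε (boolToReal f) := Nat.cast_nonneg _
  linarith

end Cube

/-! ### Expectation values as functions of the input -/

section Readout

set_option linter.unusedSectionVars false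

open scoped Matrix.Norms.L2Operator ComplexOrder MatrixOrder

section

variable {Q : Type} [Fintype Q] [DecidableEq Q]

theorem qubitAct_apply_of_agree {i : Q} (m : Matrix Bool Bool ℂ) {u v : Q → Bool}
    (h : ∀ j, j ≠ i → u j = v j) : qubitAct i m u v = m (u i) (v i) := by
  rw [qubitAct, tensorOp_apply, Finset.prod_eq_single i]
  · simp
  · intro j _ hj
    simp [hj, h j hj]
  · simp

/-- In `B ⊗ I` the entry does not depend on the common value of a qubit outside the support. It
follows by comparing one entry in the commutation relation with `|b⟩⟨u i|` on that qubit. -/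
theorem apply_update_of_mem_supportedOn {T : Finset Q} {A : QubitOp Q} (hA : A ∈ supportedOn T)
    {i : Q} (hi : i ∉ T) {u v : Q → Bool} (huv : u i = v i) (b : Bool) :
    A (Function.update u i b) (Function.update v i b) = A u v := by
  set m : Matrix Bool Bool ℂ := Matrix.single b (u i) 1 with hm
  have key := congrFun (congrFun (mem_supportedOn.1 hA i hi m) (Function.update u i b)) v
  rw [Matrix.mul_apply, Matrix.mul_apply, Finset.sum_eq_single u, Finset.sum_eq_single
    (Function.update v i b)] at key
  · rw [qubitAct_apply_of_agree m fun j hj => by simp [hj],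
      qubitAct_apply_of_agree m fun j hj => by simp [hj]] at key
    simpa [hm, huv] using key.symm
  · intro w _ hw
    obtain ⟨j, hj⟩ := Function.ne_iff.1 hw
    by_cases hag : ∀ j, j ≠ i → w j = v j
    · rw [qubitAct_apply_of_agree m hag]
      have hji : j = i := by
        by_contra hji
        exact hj (by simp [hji, hag j hji])
      subst hji
      rw [Function.update_self] at hj
      simp [hm, hj.symm]
    · push Not at hag
      obtain ⟨k, hk, hne⟩ := hag
      rw [qubitAct_apply_eq_zero m hk hne, mul_zero]
  · simp
  · intro w _ hw
    obtain ⟨j, hj⟩ := Function.ne_iff.1 hw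
    by_cases hag : ∀ j, j ≠ i → Function.update u i b j = w j
    · rw [qubitAct_apply_of_agree m hag]
      have hji : j = i := by
        by_contra hji
        exact hj (by simpa [hji] using (hag j hji).symm)
      subst hji
      simp [hm, hj.symm]
    · push Not at hag
      obtain ⟨k, hk, hne⟩ := hag
      rw [qubitAct_apply_eq_zero m hk hne, zero_mul]
  · simp

theorem apply_piecewise_of_mem_supportedOn {T : Finset Q} {A : QubitOp Q}
    (hA : A ∈ supportedOn T) (z u v : Q → Bool) (D : Finset Q) (hD : ∀ i ∈ D, i ∉ T)
    (huv : ∀ i ∈ D, u i = v i) : A (D.piecewise z u) (D.piecewise z v) = A u v := by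
  induction D using Finset.induction_on with
  | empty => simp
  | insert i D hi ih =>
    rw [Finset.piecewise_insert, Finset.piecewise_insert,
      apply_update_of_mem_supportedOn hA (hD i (Finset.mem_insert_self _ _)),
      ih (fun j hj => hD j (Finset.mem_insert_of_mem hj))
        fun j hj => huv j (Finset.mem_insert_of_mem hj)]
    simpa [hi] using huv i (Finset.mem_insert_self _ _)

/-- The expectation value of `A` in a state is bounded by the norm of `A`. -/
theorem norm_trace_mul_le (A : QubitOp Q) {ρ : QubitOp Q} (hρ : IsDensityOperator ρ) :
    ‖(A * ρ).trace‖ ≤ ‖A‖ := by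
  obtain ⟨B, hB⟩ := CStarAlgebra.nonneg_iff_eq_star_mul_self.1 hρ.1.nonneg
  replace hB : ρ = B.conjTranspose * B := hB
  subst hB
  have htr := hρ.2
  -- With `ρ = B† B`, the conjugated rows of `B` decompose the state: `Tr(Aρ) = ∑ ⟨xᵢ, A xᵢ⟩` and `∑
  -- ‖xᵢ‖² = 1`.
  set x : (Q → Bool) → EuclideanSpace ℂ (Q → Bool) := fun i => WithLp.toLp 2 (star (B i)) with hx
  have hnorm : ∑ i, ‖x i‖ ^ 2 = 1 := by
    rw [Matrix.trace_mul_comm] at htr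
    have h1 : ((∑ i, ‖x i‖ ^ 2 : ℝ) : ℂ) = (B * B.conjTranspose).trace := by
      rw [Matrix.trace, Complex.ofReal_sum]
      refine Finset.sum_congr rfl fun i _ => ?_
      rw [EuclideanSpace.norm_sq_eq, Matrix.diag_apply, Matrix.mul_apply, Complex.ofReal_sum]
      refine Finset.sum_congr rfl fun j _ => ?_
      simp only [hx, Pi.star_apply, norm_star, Matrix.conjTranspose_apply]
      rw [Complex.star_def, Complex.mul_conj', Complex.ofReal_pow]
    rw [htr] at h1
    exact_mod_cast h1
  have hdiag : (A * (B.conjTranspose * B)).trace =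
      ∑ i, inner ℂ (x i) (WithLp.toLp 2 (A.mulVec (star (B i))) : EuclideanSpace ℂ _) := by
    rw [← mul_assoc, Matrix.trace_mul_comm, ← mul_assoc, Matrix.trace]
    refine Finset.sum_congr rfl fun i _ => ?_
    rw [EuclideanSpace.inner_eq_star_dotProduct, Matrix.diag_apply, mul_assoc, Matrix.mul_apply]
    simp only [hx, star_star, dotProduct]
    refine Finset.sum_congr rfl fun j _ => ?_
    rw [mul_comm]
    congr 1
  rw [hdiag]
  calc _ ≤ ∑ i, ‖inner ℂ (x i) (WithLp.toLp 2 (A.mulVec (star (B i))) : EuclideanSpace ℂ _)‖ :=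
        norm_sum_le _ _
    _ ≤ ∑ i, ‖A‖ * ‖x i‖ ^ 2 := by
        refine Finset.sum_le_sum fun i _ => (norm_inner_le_norm _ _).trans ?_
        have := Matrix.l2_opNorm_mulVec A (x i)
        calc _ ≤ ‖x i‖ * (‖A‖ * ‖x i‖) := by
              gcongr
              exact this
          _ = _ := by ring
    _ = ‖A‖ := by rw [← Finset.mul_sum, hnorm, mul_one]

end

variable {n a : ℕ}

/-- The isometry `φ ↦ |x⟩ ⊗ φ`. -/
def inputIsometry (a : ℕ) (x : Fin n → Bool) : Matrix (Fin n ⊕ Fin a → Bool) (Fin a → Bool) ℂ :=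
  (1 : QubitOp (Fin n ⊕ Fin a)).submatrix id fun w => Sum.elim x w

/-- This form makes positivity and trace one immediate, and turns expectations into traces of the
block of the observable at input `x`. -/
theorem initialState_eq (φ : QubitOp (Fin a)) (x : Fin n → Bool) :
    initialState φ x = inputIsometry a x * φ * (inputIsometry a x).conjTranspose := by
  have hE : ∀ (u : Fin n ⊕ Fin a → Bool) (w : Fin a → Bool), inputIsometry a x u w =
      if (∀ i, u (Sum.inl i) = x i) ∧ (fun j => u (Sum.inr j)) = w then 1 else 0 := by
    intro u w
    rw [inputIsometry, Matrix.submatrix_apply, Matrix.one_apply]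
    congr 1
    simp only [id, funext_iff, Sum.forall, Sum.elim_inl, Sum.elim_inr]
  ext u v
  rw [Matrix.mul_apply]
  simp only [Matrix.mul_apply, Matrix.conjTranspose_apply, hE, initialState, Matrix.of_apply]
  by_cases hu : ∀ i, u (Sum.inl i) = x i <;> by_cases hv : ∀ i, v (Sum.inl i) = x i <;>
    simp [hu, hv, apply_ite star]

theorem inputIsometry_conjTranspose_mul_mul (B : QubitOp (Fin n ⊕ Fin a)) (x : Fin n → Bool) :
    (inputIsometry a x).conjTranspose * B * inputIsometry a x =
      B.submatrix (fun w => Sum.elim x w) fun w => Sum.elim x w := by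
  ext w w'
  rw [Matrix.mul_apply]
  simp [inputIsometry, Matrix.mul_apply, Matrix.one_apply]

theorem inputIsometry_conjTranspose_mul (x : Fin n → Bool) :
    (inputIsometry a x).conjTranspose * inputIsometry a x = 1 := by
  have h := inputIsometry_conjTranspose_mul_mul (1 : QubitOp (Fin n ⊕ Fin a)) x
  rw [Matrix.mul_one] at h
  rw [h]
  exact Matrix.submatrix_one _ fun w w' h => funext fun j => congrFun h (Sum.inr j)

theorem isDensityOperator_initialState {φ : QubitOp (Fin a)} (hφ : IsDensityOperator φ)
    (x : Fin n → Bool) : IsDensityOperator (initialState φ x) := by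
  rw [initialState_eq]
  refine ⟨hφ.1.mul_mul_conjTranspose_same _, ?_⟩
  rw [Matrix.trace_mul_comm, ← Matrix.mul_assoc, inputIsometry_conjTranspose_mul, Matrix.one_mul,
    hφ.2]

theorem trace_mul_initialState (B : QubitOp (Fin n ⊕ Fin a)) (φ : QubitOp (Fin a))
    (x : Fin n → Bool) : (B * initialState φ x).trace =
      (B.submatrix (fun w => Sum.elim x w) (fun w => Sum.elim x w) * φ).trace := by
  rw [initialState_eq, ← inputIsometry_conjTranspose_mul_mul, ← Matrix.mul_assoc,
    ← Matrix.mul_assoc, Matrix.trace_mul_comm, ← Matrix.mul_assoc, ← Matrix.mul_assoc]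

theorem trace_mul_initialState_congr {T : Finset (Fin n ⊕ Fin a)} {B : QubitOp (Fin n ⊕ Fin a)}
    (hB : B ∈ supportedOn T) (φ : QubitOp (Fin a)) {x y : Fin n → Bool}
    (hxy : ∀ i, Sum.inl i ∈ T → x i = y i) :
    (B * initialState φ x).trace = (B * initialState φ y).trace := by
  rw [trace_mul_initialState, trace_mul_initialState]
  congr 2
  ext w w'
  rw [Matrix.submatrix_apply, Matrix.submatrix_apply]
  -- The input qubits where `x` and `y` differ all lie outside `T`; overwriting them turns `y` into
  -- `x` without changing the entries of `B`.
  set D : Finset (Fin n ⊕ Fin a) :=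
    (Finset.univ.filter fun i => x i ≠ y i).map Function.Embedding.inl with hD
  have hpw : ∀ w : Fin a → Bool,
      Sum.elim x w = D.piecewise (Sum.elim x fun _ => false) (Sum.elim y w) := by
    intro w
    funext q
    rcases q with i | j
    · by_cases h : x i = y i <;> simp [hD, Finset.piecewise, h]
    · simp [hD, Finset.piecewise]
  rw [hpw w, hpw w']
  refine apply_piecewise_of_mem_supportedOn hB _ _ _ D (fun q hq hqT => ?_) fun q hq => ?_
  · obtain ⟨i, hi, rfl⟩ := Finset.mem_map.1 hq
    exact (Finset.mem_filter.1 hi).2 (hxy i hqT)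
  · obtain ⟨i, hi, rfl⟩ := Finset.mem_map.1 hq
    rfl

theorem trace_mul_initialState_mem_cubeDegreeLE {r : ℝ} {B : QubitOp (Fin n ⊕ Fin a)}
    (hB : B ∈ opDegreeLE (Fin n ⊕ Fin a) r) (φ : QubitOp (Fin a)) :
    (fun x : Fin n → Bool => (B * initialState φ x).trace.re) ∈ cubeDegreeLE n r := by
  -- Complex scalars mix real and imaginary parts, so the span induction must carry both.
  suffices h : (fun x : Fin n → Bool => (B * initialState φ x).trace.re) ∈ cubeDegreeLE n r ∧
      (fun x : Fin n → Bool => (B * initialState φ x).trace.im) ∈ cubeDegreeLE n r from h.1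
  induction hB using Submodule.span_induction with
  | mem B hB =>
    obtain ⟨T, hT, hBT⟩ := hB
    have hcard : (((Finset.univ.filter fun i : Fin n => Sum.inl i ∈ T).card : ℕ) : ℝ) ≤ r := by
      refine le_trans (Nat.cast_le.2 ?_) hT
      refine Finset.card_le_card_of_injOn Sum.inl (fun i hi => ?_) Sum.inl_injective.injOn
      exact (Finset.mem_filter.1 hi).2
    have hcongr : ∀ x y : Fin n → Bool,
        (∀ i ∈ Finset.univ.filter fun i : Fin n => Sum.inl i ∈ T, x i = y i) →
        (B * initialState φ x).trace = (B * initialState φ y).trace := fun x y hxy =>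
      trace_mul_initialState_congr hBT φ fun i hi => hxy i (by simpa using hi)
    exact ⟨mem_cubeDegreeLE hcard fun x y hxy => by rw [hcongr x y hxy],
      mem_cubeDegreeLE hcard fun x y hxy => by rw [hcongr x y hxy]⟩
  | zero =>
    have h0 : (fun _ : Fin n → Bool => (0 : ℝ)) ∈ cubeDegreeLE n r := Submodule.zero_mem _
    simpa using h0
  | add B B' _ _ h h' =>
    simp only [add_mul, Matrix.trace_add, Complex.add_re, Complex.add_im]
    exact ⟨Submodule.add_mem _ h.1 h'.1, Submodule.add_mem _ h.2 h'.2⟩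
  | smul c B _ h =>
    simp only [Matrix.smul_mul, Matrix.trace_smul, smul_eq_mul, Complex.mul_re, Complex.mul_im]
    exact ⟨Submodule.sub_mem _ (Submodule.smul_mem _ c.re h.1) (Submodule.smul_mem _ c.im h.2),
      Submodule.add_mem _ (Submodule.smul_mem _ c.re h.2) (Submodule.smul_mem _ c.im h.1)⟩

/-! ### Output probabilities -/

variable {d : ℕ}

theorem outputProbability_eq (U : QACCircuit (Fin n ⊕ Fin a) d) (o : Fin n ⊕ Fin a)
    (φ : QubitOp (Fin a)) (x : Fin n → Bool) (b : Bool) :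
    outputProbability U o φ x b =
      (U.toOp.conjTranspose * measurementProjector o b * U.toOp * initialState φ x).trace.re := by
  rw [outputProbability, ← mul_assoc, Matrix.trace_mul_comm]
  simp only [mul_assoc]

theorem outputProbability_nonneg (U : QACCircuit (Fin n ⊕ Fin a) d) (o : Fin n ⊕ Fin a)
    {φ : QubitOp (Fin a)} (hφ : IsDensityOperator φ) (x : Fin n → Bool) (b : Bool) :
    0 ≤ outputProbability U o φ x b := by
  have hpos := (isDensityOperator_initialState hφ x).1.mul_mul_conjTranspose_same U.toOp
  rw [outputProbability, Matrix.trace, Complex.re_sum]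
  refine Finset.sum_nonneg fun u _ => ?_
  rw [Matrix.diag_apply, measurementProjector, Matrix.diagonal_mul]
  have h : 0 ≤ (U.toOp * initialState φ x * U.toOp.conjTranspose) u u := hpos.diag_nonneg
  have h' := (Complex.le_def.1 h).1
  split_ifs
  · simpa using h'
  · simp

theorem measurementProjector_add (o : Fin n ⊕ Fin a) (b : Bool) :
    measurementProjector o b + measurementProjector o (!b) = 1 := by
  rw [measurementProjector, measurementProjector, Matrix.diagonal_add, ← Matrix.diagonal_one]
  congr 1
  funext u
  cases b <;> cases h : u o <;> simp

theorem outputProbability_add (U : QACCircuit (Fin n ⊕ Fin a) d) (o : Fin n ⊕ Fin a)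
    {φ : QubitOp (Fin a)} (hφ : IsDensityOperator φ) (x : Fin n → Bool) (b : Bool) :
    outputProbability U o φ x b + outputProbability U o φ x (!b) = 1 := by
  rw [outputProbability_eq, outputProbability_eq, ← Complex.add_re, ← Matrix.trace_add, ← add_mul,
    ← add_mul, ← mul_add, measurementProjector_add, mul_one, U.toOp_conjTranspose_mul, one_mul,
    (isDensityOperator_initialState hφ x).2, Complex.one_re]

/-- The outcome probabilities are nonnegative and sum to one, so the left side is the probability of
the wrong outcome. -/
theorem ComputesWithError.abs_sub_le {U : QACCircuit (Fin n ⊕ Fin a) d} {o : Fin n ⊕ Fin a}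
    {φ : QubitOp (Fin a)} {f : (Fin n → Bool) → Bool} {δ : ℝ} (hφ : IsDensityOperator φ)
    (h : ComputesWithError U o φ f δ) (x : Fin n → Bool) :
    |boolToReal f x - outputProbability U o φ x true| ≤ δ := by
  have h1 := h x
  have h2 := outputProbability_nonneg U o hφ x true
  have h3 := outputProbability_nonneg U o hφ x false
  have h4 := outputProbability_add U o hφ x true
  rw [Bool.not_true] at h4
  unfold boolToReal
  cases hf : f x
  · rw [hf, Bool.not_false] at h1
    simpa [abs_of_nonneg h2] using h1
  · rw [hf, Bool.not_true] at h1
    rw [if_pos rfl, abs_le]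
    constructor <;> linarith

theorem ComputesWithError.nonneg {U : QACCircuit (Fin n ⊕ Fin a) d} {o : Fin n ⊕ Fin a}
    {φ : QubitOp (Fin a)} {f : (Fin n → Bool) → Bool} {δ : ℝ} (hφ : IsDensityOperator φ)
    (h : ComputesWithError U o φ f δ) : 0 ≤ δ :=
  (abs_nonneg _).trans (h.abs_sub_le hφ fun _ => false)

theorem norm_measurementProjector_le {Q : Type} [Fintype Q] [DecidableEq Q] (o : Q) (b : Bool) :
    ‖measurementProjector o b‖ ≤ 1 := by
  rw [measurementProjector, Matrix.l2_opNorm_diagonal]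
  refine (pi_norm_le_iff_of_nonneg zero_le_one).2 fun u => ?_
  split_ifs <;> simp

theorem measurementProjector_mem_opDegreeLE {Q : Type} [Fintype Q] [DecidableEq Q] (o : Q)
    (b : Bool) : measurementProjector o b ∈ opDegreeLE Q 1 :=
  mem_opDegreeLE_of_mem_supportedOn (T := {o})
    (diagonal_mem_supportedOn fun u v huv => by rw [huv o (by simp)]) (by simp)

/-- The degree bound with explicit parameters. -/
theorem approxDegree_le_of_computesWithError (hn : 1 ≤ n) {Λ : ℝ} (hΛ : 1 ≤ Λ)
    {U : QACCircuit (Fin n ⊕ Fin a) d} {o : Fin n ⊕ Fin a} {φ : QubitOp (Fin a)}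
    {f : (Fin n → Bool) → Bool} {δ ε : ℝ} (hφ : IsDensityOperator φ)
    (h : ComputesWithError U o φ f δ)
    (hε : d * (2 * (((n : ℝ) + a) * (8 * Real.exp (-(2 * Λ))))) ≤ ε) :
    (approxDegree (δ + ε) (boolToReal f) : ℝ) ≤
      (1 + 8 * Λ * d) * ((n : ℝ) + a) ^ (1 - (1 / 3 : ℝ) ^ d) := by
  have hcard : (Fintype.card (Fin n ⊕ Fin a) : ℝ) = (n : ℝ) + a := by simp
  -- At level `j = 0` the admissible degree is `N ^ 0 = 1`, and the projector is its own
  -- approximation with zero error.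
  obtain ⟨B, hB, hB'⟩ := exists_approx_heisenberg hΛ (by simp; omega) U 0 (η := 0)
    (norm_measurementProjector_le o true) (by simp : ‖_ - measurementProjector o true‖ ≤ 0)
    (by simpa using measurementProjector_mem_opDegreeLE o true)
  rw [hcard, zero_add] at hB
  rw [hcard, zero_add] at hB'
  set g : (Fin n → Bool) → ℝ := fun x => (B * initialState φ x).trace.re
  have hg := fourierDegree_le (by positivity) (trace_mul_initialState_mem_cubeDegreeLE hB φ)
  refine le_trans (Nat.cast_le.2 (approxDegree_le (g := g) fun x => ?_)) hg
  have h1 := h.abs_sub_le hφ x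
  have h2 : |outputProbability U o φ x true - g x| ≤ ε := by
    rw [outputProbability_eq, ← Complex.sub_re, ← Matrix.trace_sub, ← sub_mul]
    refine (Complex.abs_re_le_norm _).trans ?_
    exact (norm_trace_mul_le _ (isDensityOperator_initialState hφ x)).trans (hB'.trans hε)
  exact (abs_sub_le _ _ _).trans (add_le_add h1 h2)

end Readout

/-! ### The main theorem -/

/-- Nonnegativity of `ε` matters: for negative `ε` no approximant exists and the infimum defaults to
`0`. -/
theorem approxDegree_anti {n : ℕ} {ε ε' : ℝ} (hε : 0 ≤ ε) (h : ε ≤ ε')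
    (f : (Fin n → Bool) → ℝ) : approxDegree ε' f ≤ approxDegree ε f := by
  obtain ⟨g, hg, hdeg⟩ := exists_fourierDegree_eq_approxDegree hε f
  exact hdeg ▸ approxDegree_le fun x => (hg x).trans h

/-- A `QAC` circuit of depth `d` on `N` qubits computes functions of approximate degree
`Õ(N ^ (1 - 3 ^ (-d)))`. -/
theorem approxDegree_le_rpow_mul_log_sq {κ : ℝ} (hκ : 0 < κ) : ∃ C : ℝ, 0 < C ∧
    ∀ (n a d : ℕ), 1 ≤ n →
    ∀ (U : QACCircuit (Fin n ⊕ Fin a) d) (o : Fin n ⊕ Fin a) (φ : QubitOp (Fin a))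
      (f : (Fin n → Bool) → Bool) (δ : ℝ),
      IsDensityOperator φ → ComputesWithError U o φ f δ →
      (approxDegree (δ + κ * ((d : ℝ) / (n : ℝ))) (boolToReal f) : ℝ) ≤
        C * ((n : ℝ) + (a : ℝ)) ^ (1 - (1 / 3 : ℝ) ^ d) *
          Real.log ((n : ℝ) + (a : ℝ) + 1) ^ 2 := by
  -- Chosen so that `Λ = log (c (N + 1))` is at least one and the error per layer, `16 N / (c (N +
  -- 1))²`, is at most `κ / n`.
  set c : ℝ := 16 / κ + 16 with hc
  have hκ' : 0 < 16 / κ := by positivity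
  have hc1 : 16 ≤ c := by linarith
  have hcκ : 16 ≤ κ * c := by
    rw [hc, mul_add, mul_div_cancel₀ _ hκ.ne']
    linarith [mul_pos hκ (show (0 : ℝ) < 16 by norm_num)]
  have hlogc : 0 ≤ Real.log c := Real.log_nonneg (by linarith)
  refine ⟨12 + 8 * (2 * Real.log c + 1), by positivity, fun n a d hn U o φ f δ hφ hU => ?_⟩
  have hn' : (1 : ℝ) ≤ n := mod_cast hn
  have ha' : (0 : ℝ) ≤ a := Nat.cast_nonneg a
  set N : ℝ := (n : ℝ) + a with hN
  have hN1 : 1 ≤ N := by linarith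
  have hN0 : 0 < N := by linarith
  set ℓ : ℝ := Real.log (N + 1) with hℓ
  have hℓ2 : 1 / 2 ≤ ℓ := by
    have h1 : Real.log 2 ≤ ℓ := Real.log_le_log (by norm_num) (by linarith)
    have h2 := Real.log_two_gt_d9
    norm_num at h2
    linarith
  have hδ : 0 ≤ δ := hU.nonneg hφ
  have hsq : 1 ≤ 4 * ℓ ^ 2 := by nlinarith
  set P : ℝ := N ^ (1 - (1 / 3 : ℝ) ^ d) with hP
  have hP0 : 0 < P := Real.rpow_pos_of_pos hN0 _
  -- This makes `C` independent of `d`. For deep circuits `N ^ (3⁻ᵈ) ≤ e`, so the trivial degree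
  -- bound `n` suffices; otherwise `d ≤ 3 ^ d < log N`, and the factor `1 + 8 Λ d` is `O(log² N)`.
  rcases le_or_gt (Real.log N) ((3 : ℝ) ^ d) with hsmall | hlarge
  · have h1 : (approxDegree (δ + κ * ((d : ℝ) / (n : ℝ))) (boolToReal f) : ℝ) ≤ n :=
      mod_cast approxDegree_le_card (by positivity) _
    have h2 : N ^ ((1 / 3 : ℝ) ^ d) ≤ 3 := by
      rw [Real.rpow_def_of_pos hN0]
      refine le_trans (Real.exp_le_exp.2 ?_) Real.exp_one_lt_three.le
      rw [one_div, inv_pow, ← div_eq_mul_inv]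
      exact (div_le_one (by positivity)).2 hsmall
    have h3 : N = P * N ^ ((1 / 3 : ℝ) ^ d) := by
      rw [hP, ← Real.rpow_add hN0, sub_add_cancel, Real.rpow_one]
    calc _ ≤ (n : ℝ) := h1
      _ ≤ N := by linarith
      _ = P * N ^ ((1 / 3 : ℝ) ^ d) := h3
      _ ≤ P * 3 := by gcongr
      _ ≤ P * (3 * (4 * ℓ ^ 2)) := by gcongr; linarith
      _ = 12 * P * ℓ ^ 2 := by ring
      _ ≤ _ := by gcongr; linarith
  · have hd : (d : ℝ) ≤ ℓ := by
      have h1 : (d : ℝ) ≤ (3 : ℝ) ^ d := mod_cast (Nat.lt_pow_self (n := d) (by norm_num)).le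
      have h2 : Real.log N ≤ ℓ := Real.log_le_log hN0 (by linarith)
      linarith
    set Λ : ℝ := Real.log (c * (N + 1)) with hΛdef
    have hΛeq : Λ = Real.log c + ℓ := Real.log_mul (by positivity) (by positivity)
    have hΛ1 : 1 ≤ Λ := by
      rw [hΛdef, Real.le_log_iff_exp_le (by positivity)]
      have := Real.exp_one_lt_three
      nlinarith
    have hΛle : Λ ≤ (2 * Real.log c + 1) * ℓ := by nlinarith
    have hexp : Real.exp (-(2 * Λ)) = 1 / (c * (N + 1)) ^ 2 := by
      rw [Real.exp_neg, two_mul, Real.exp_add, Real.exp_log (by positivity), one_div, sq]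
    have hε : d * (2 * (N * (8 * Real.exp (-(2 * Λ))))) ≤ κ * ((d : ℝ) / (n : ℝ)) := by
      have : 2 * (N * (8 * Real.exp (-(2 * Λ)))) ≤ κ / n := by
        rw [hexp, le_div_iff₀ (by linarith)]
        have h1 : 2 * (N * (8 * (1 / (c * (N + 1)) ^ 2))) * n = 16 * N * n / (c * (N + 1)) ^ 2 := by
          ring
        rw [h1, div_le_iff₀ (by positivity)]
        calc 16 * N * n ≤ 16 * N * N := by gcongr; linarith
          _ = 16 * N ^ 2 := by ring
          _ ≤ (κ * c) * (N + 1) ^ 2 := by gcongr; linarith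
          _ ≤ (κ * c) * c * (N + 1) ^ 2 := by
            have : κ * c ≤ κ * c * c := le_mul_of_one_le_right (by positivity) (by linarith)
            gcongr
          _ = κ * (c * (N + 1)) ^ 2 := by ring
      calc _ ≤ (d : ℝ) * (κ / n) := by gcongr
        _ = _ := by ring
    refine (approxDegree_le_of_computesWithError hn hΛ1 hφ hU hε).trans ?_
    calc (1 + 8 * Λ * d) * P
        ≤ (4 * ℓ ^ 2 + 8 * ((2 * Real.log c + 1) * ℓ) * ℓ) * P := by gcongr
      _ = (4 + 8 * (2 * Real.log c + 1)) * P * ℓ ^ 2 := by ring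
      _ ≤ _ := by gcongr; norm_num

/-- The growth comparison behind the lower bound on the number of ancillae. -/
theorem eventually_rpow_mul_log_pow_lt {θ c C : ℝ} (hθ : 0 < θ) (hθ1 : θ ≤ 1) (hc : 0 < c)
    (hC : 0 < C) (K : ℕ) : ∃ n₀ : ℕ, ∀ n : ℕ, n₀ ≤ n → ∀ a : ℕ, (a : ℝ) < (n : ℝ) ^ (1 + θ) →
      C * ((n : ℝ) + a) ^ (1 - θ) * Real.log ((n : ℝ) + a + 1) ^ K < c * n := by
  -- As `(1 + θ)(1 - θ) = 1 - θ²`, a factor `n ^ (θ²)` is left to absorb the logarithms; the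
  -- constant leaves `c n / 2` at the end.
  have hlog := (isLittleO_log_rpow_rpow_atTop (K : ℝ) (show 0 < θ ^ 2 by positivity)).def
    (show 0 < c / (4 * C * 4 ^ K) by positivity)
  obtain ⟨n₁, hn₁⟩ := Filter.eventually_atTop.1 (tendsto_natCast_atTop_atTop.eventually hlog)
  refine ⟨max n₁ 2, fun n hn a ha => ?_⟩
  have hn2 : (2 : ℝ) ≤ n := mod_cast (le_max_right _ _).trans hn
  have hn0 : (0 : ℝ) < n := by linarith
  have hlogn : 0 < Real.log n := Real.log_pos (by linarith)
  have ha0 : (0 : ℝ) ≤ a := Nat.cast_nonneg a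
  have h1 := hn₁ n ((le_max_left _ _).trans hn)
  rw [Real.rpow_natCast, Real.norm_of_nonneg (by positivity), Real.norm_of_nonneg (by positivity)]
    at h1
  have hpow : (n : ℝ) ≤ (n : ℝ) ^ (1 + θ) := by
    simpa using Real.rpow_le_rpow_of_exponent_le (by linarith : (1 : ℝ) ≤ n)
      (by linarith : 1 ≤ 1 + θ)
  have hpow2 : (n : ℝ) ^ (1 + θ) ≤ (n : ℝ) ^ 2 := by
    simpa using Real.rpow_le_rpow_of_exponent_le (by linarith : (1 : ℝ) ≤ n)
      (by push_cast; linarith : 1 + θ ≤ ((2 : ℕ) : ℝ))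
  have h2 : ((n : ℝ) + a) ^ (1 - θ) ≤ 2 * (n : ℝ) ^ (1 - θ ^ 2) := by
    calc ((n : ℝ) + a) ^ (1 - θ) ≤ (2 * (n : ℝ) ^ (1 + θ)) ^ (1 - θ) :=
          Real.rpow_le_rpow (by positivity) (by linarith) (by linarith)
      _ = 2 ^ (1 - θ) * (n : ℝ) ^ (1 - θ ^ 2) := by
          rw [Real.mul_rpow (by norm_num) (by positivity), ← Real.rpow_mul hn0.le]
          congr 2
          ring
      _ ≤ 2 ^ (1 : ℝ) * (n : ℝ) ^ (1 - θ ^ 2) := by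
          gcongr
          · norm_num
          · linarith
      _ = _ := by rw [Real.rpow_one]
  have h3 : Real.log ((n : ℝ) + a + 1) ≤ 4 * Real.log n := by
    have : 4 * Real.log n = Real.log ((n : ℝ) ^ 4) := by
      rw [Real.log_pow]
      norm_num
    rw [this]
    refine Real.log_le_log (by positivity) ?_
    nlinarith [sq_nonneg ((n : ℝ) ^ 2 - 4)]
  have h4 : 0 ≤ Real.log ((n : ℝ) + a + 1) := Real.log_nonneg (by linarith)
  calc C * ((n : ℝ) + a) ^ (1 - θ) * Real.log ((n : ℝ) + a + 1) ^ K
      ≤ C * (2 * (n : ℝ) ^ (1 - θ ^ 2)) * (4 * Real.log n) ^ K := by gcongr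
    _ = C * (2 * (n : ℝ) ^ (1 - θ ^ 2)) * 4 ^ K * Real.log n ^ K := by rw [mul_pow]; ring
    _ ≤ C * (2 * (n : ℝ) ^ (1 - θ ^ 2)) * 4 ^ K * (c / (4 * C * 4 ^ K) * (n : ℝ) ^ (θ ^ 2)) := by
        gcongr
    _ = c / 2 * ((n : ℝ) ^ (1 - θ ^ 2) * (n : ℝ) ^ (θ ^ 2)) := by
        field_simp
        ring
    _ = c / 2 * n := by rw [← Real.rpow_add hn0, sub_add_cancel, Real.rpow_one]
    _ < c * n := by nlinarith

theorem mainTheorem3 :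
    (∃ K : ℕ, ∀ κ : ℝ, 0 < κ → ∃ C : ℝ, 0 < C ∧
      ∀ (n a d : ℕ), 1 ≤ n →
      ∀ (U : QACCircuit (Fin n ⊕ Fin a) d) (o : Fin n ⊕ Fin a) (φ : QubitOp (Fin a))
        (f : (Fin n → Bool) → Bool) (δ : ℝ),
        IsDensityOperator φ → ComputesWithError U o φ f δ →
        (approxDegree (δ + κ * ((d : ℝ) / (n : ℝ))) (boolToReal f) : ℝ) ≤
          C * ((n : ℝ) + (a : ℝ)) ^ (1 - (1 / 3 : ℝ) ^ d) *
            Real.log ((n : ℝ) + (a : ℝ) + 1) ^ K) ∧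
    (∃ K : ℕ, ∀ c : ℝ, 0 < c → ∀ δ : ℝ, δ < 1 / 2 → ∃ C : ℝ, 0 < C ∧
      ∀ d : ℕ, ∃ n₀ : ℕ, ∀ (n a : ℕ), n₀ ≤ n →
      ∀ (U : QACCircuit (Fin n ⊕ Fin a) d) (o : Fin n ⊕ Fin a) (φ : QubitOp (Fin a))
        (f : (Fin n → Bool) → Bool),
        IsDensityOperator φ → ComputesWithError U o φ f δ →
        c * (n : ℝ) ≤ (approxDegree (1 / 3) (boolToReal f) : ℝ) →
        C * (n : ℝ) ^ (1 + (1 / 3 : ℝ) ^ d) / Real.log ((n : ℝ) + 1) ^ K ≤ (a : ℝ)) := by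
  -- In the second part no logarithm is lost and `C = 1` works, because `n₀` may depend on `d` and
  -- the slack `n ^ (θ²)` beats all constants and logarithms.
  refine ⟨⟨2, fun κ hκ => approxDegree_le_rpow_mul_log_sq hκ⟩, 0, fun c hc δ hδ => ⟨1, one_pos, ?_⟩⟩
  intro d
  obtain ⟨C, hC, hmain⟩ := approxDegree_le_rpow_mul_log_sq one_pos
  have hmax0 : 0 ≤ max δ 0 := le_max_right _ _
  have hmax : max δ 0 < 1 / 2 := max_lt hδ (by norm_num)
  -- A target strictly between `δ` and `1/2`, leaving room for the extra error `d / n` once `n ≥ d /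
  -- (ε - δ)`. The maximum with `0` keeps `ε` nonnegative before a circuit, which forces `0 ≤ δ`, is
  -- given.
  set ε : ℝ := (max δ 0 + 1 / 2) / 2 with hε
  have hδε : δ < ε := by linarith [le_max_left δ 0]
  obtain ⟨R, hR, hamp⟩ := exists_amplification (ε := ε) (by linarith) (by linarith)
  have hR' : (1 : ℝ) ≤ R := mod_cast hR
  obtain ⟨n₁, hn₁⟩ := eventually_rpow_mul_log_pow_lt (θ := (1 / 3 : ℝ) ^ d) (by positivity)
    (pow_le_one₀ (by norm_num) (by norm_num)) hc (show 0 < R * C by positivity) 2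
  refine ⟨max n₁ (⌈(d : ℝ) / (ε - δ)⌉₊ + 1), fun n a hn U o φ f hφ hU hdeg => ?_⟩
  have hn1 : 1 ≤ n := by omega
  have hn0 : (0 : ℝ) < n := mod_cast hn1
  rw [one_mul, pow_zero, div_one]
  by_contra! ha
  have hlt := hn₁ n ((le_max_left _ _).trans hn) a ha
  have hδ0 : 0 ≤ δ := hU.nonneg hφ
  have herr : δ + 1 * ((d : ℝ) / n) ≤ ε := by
    have h1 : (d : ℝ) / (ε - δ) ≤ n := (Nat.le_ceil _).trans (Nat.cast_le.2 (by omega))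
    rw [div_le_iff₀ (by linarith)] at h1
    have h2 : (d : ℝ) / n ≤ ε - δ := by
      rw [div_le_iff₀ hn0]
      linarith
    linarith
  have h1 : (approxDegree ε (boolToReal f) : ℝ) ≤
      approxDegree (δ + 1 * ((d : ℝ) / n)) (boolToReal f) :=
    mod_cast approxDegree_anti (by positivity) herr _
  have h2 := h1.trans (hmain n a d hn1 U o φ f δ hφ hU)
  have h3 := hamp n f
  have h4 : c * (n : ℝ) ≤ R * (C * ((n : ℝ) + a) ^ (1 - (1 / 3 : ℝ) ^ d) *
      Real.log ((n : ℝ) + a + 1) ^ 2) :=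
    hdeg.trans (h3.trans (by gcongr))
  linarith
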